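/- All graphs are finite and undirected, have at least one vertex and no multiple edges, and may have loops; they are considered up to isomorphism. A $(1,1)$-bilabelled graph is a triple $\boldsymbol{F}=(F,u,v)$ of a graph $F$, its underlying unlabelled graph, and vertices $u,v\in V(F)$, possibly equal (the in-label and the out-label). It is atomic if $V(F)=\{u,v\}$. For $\boldsymbol{F}=(F,u,v)$ and $\boldsymbol{F}'=(F',u',v')$, the series composition $\boldsymbol{F}\cdot\boldsymbol{F}'$ is the disjoint union of $F$ and $F'$ with $v$ and $u'$ identified, with in-label $u$ and out-label $v'$; the parallel composition $\boldsymbol{F}\odot\boldsymbol{F}'$ is the disjoint union of $F$ and $F'$ with $u$ and $u'$ identified and $v$ and $v'$ identified, with these vertices as in-label and out-label. In both cases, multiple edges are merged, and an edge whose ends are identified becomes a loop. Let $\mathcal{L}_1$ be the smallest class of $(1,1)$-bilabelled graphs that contains all atomic graphs and is closed under series composition, under parallel composition with atomic graphs, and under swapping the two labels. A graph is outerplanar if neither $K_4$ nor $K_{2,3}$ is a minor of it. The expansion of $(F,u,v)$ is the graph obtained from $F$ by adding a new vertex $x$ and the edges $ux$ and $xv$ (a single edge if $u=v$). Let $\mathcal{OP}$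 be the class of $(1,1)$-bilabelled graphs whose expansion is outerplanar. Then $\mathcal{L}_1=\mathcal{OP}$. Moreover, a graph is isomorphic to the underlying unlabelled graph of some element of $\mathcal{L}_1$ if and only if it is outerplanar. -/

import Mathlib

universe u v

/-- An undirected graph on the vertex set `V` without multiple edges, in which loops are allowed. -/
structure LoopGraph (V : Type u) where
  Adj : V → V → Prop
  symm : ∀ ⦃x y : V⦄, Adj x y → Adj y x

namespace LoopGraph

variable {V : Type u} {V' : Type v}

/-- The simple graph obtained by deleting all loops. -/
def deleteLoops (G : LoopGraph V) : SimpleGraph V where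
  Adj x y := x ≠ y ∧ G.Adj x y
  symm := ⟨fun _ _ h => ⟨h.1.symm, G.symm h.2⟩⟩
  loopless := ⟨fun _ h => h.1 rfl⟩

/-- The simple graph `H` is a minor of the graph `G` (which may have loops): there are pairwise
disjoint branch sets in `G`, one for each vertex of `H`, each of them non-empty and connected
(loops are irrelevant for connectedness), such that adjacent vertices of `H` have branch sets
that are joined by an edge of `G`. -/
def HasMinor {W : Type*} (G : LoopGraph V) (H : SimpleGraph W) : Prop :=
  ∃ B : W → Set V,
    (∀ a, (G.deleteLoops.induce (B a)).Connected) ∧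
    (∀ a b, a ≠ b → Disjoint (B a) (B b)) ∧
    (∀ a b, H.Adj a b → ∃ x ∈ B a, ∃ y ∈ B b, G.Adj x y)

/-- A graph is outerplanar if neither `K₄` nor `K_{2,3}` is a minor of it. -/
def IsOuterplanar (G : LoopGraph V) : Prop :=
  ¬ G.HasMinor (⊤ : SimpleGraph (Fin 4)) ∧
  ¬ G.HasMinor (completeBipartiteGraph (Fin 2) (Fin 3))

/-- The disjoint union of two graphs. -/
def disjointUnion (G : LoopGraph V) (G' : LoopGraph V') : LoopGraph (V ⊕ V') where
  Adj := Sum.LiftRel G.Adj G'.Adj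
  symm := by
    intro x y h
    cases h with
    | inl h => exact .inl (G.symm h)
    | inr h => exact .inr (G'.symm h)

/-- The graph obtained from `G` by identifying all pairs of vertices related by `r`. The vertex
set `Quot r` is the quotient by the equivalence relation generated by `r`. Multiple edges are
dropped; an edge whose two ends are identified becomes a loop. -/
def identify (G : LoopGraph V) (r : V → V → Prop) : LoopGraph (Quot r) where
  Adj p q := ∃ x y, Quot.mk r x = p ∧ Quot.mk r y = q ∧ G.Adj x y
  symm := by
    rintro p q ⟨x, y, hx, hy, h⟩
    exact ⟨y, x, hy, hx, G.symm h⟩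

/-- The graph obtained from `G` by adding a path of length two between `a` and `b`, i.e. a new
vertex `none` whose neighbours are exactly `a` and `b`. -/
def addPath (G : LoopGraph V) (a b : V) : LoopGraph (Option V) where
  Adj
    | some x, some y => G.Adj x y
    | some x, none => x = a ∨ x = b
    | none, some y => y = a ∨ y = b
    | none, none => False
  symm := by
    rintro (_ | x) (_ | y) h
    · exact h
    · exact h
    · exact h
    · exact G.symm h

end LoopGraph

/-- A `(t,t)`-bilabelled graph: a finite graph (loops allowed) with `t` in-labels and `t`
out-labels on its vertices; a vertex may carry several labels. -/
structure BilabelledGraph (t : ℕ) where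
  V : Type u
  finite : Finite V
  graph : LoopGraph V
  inLabel : Fin t → V
  outLabel : Fin t → V

namespace BilabelledGraph

variable {t : ℕ}

attribute [instance] BilabelledGraph.finite

/-- Isomorphism of bilabelled graphs. -/
def IsIso (F F' : BilabelledGraph.{u} t) : Prop :=
  ∃ e : F.graph.Adj ≃r F'.graph.Adj,
    (∀ i, e (F.inLabel i) = F'.inLabel i) ∧ (∀ i, e (F.outLabel i) = F'.outLabel i)

/-- A bilabelled graph is atomic if all its vertices are labelled. -/
def IsAtomic (F : BilabelledGraph.{u} t) : Prop :=
  ∀ x : F.V, (∃ i, F.inLabel i = x) ∨ (∃ i, F.outLabel i = x)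

/-- The identifications made by series composition: the `i`-th out-label of `F` with the `i`-th
in-label of `F'`. -/
inductive SeriesRel (F F' : BilabelledGraph.{u} t) : F.V ⊕ F'.V → F.V ⊕ F'.V → Prop
  | glue (i : Fin t) : SeriesRel F F' (.inl (F.outLabel i)) (.inr (F'.inLabel i))

/-- Series composition `F · F'`. -/
def series (F F' : BilabelledGraph.{u} t) : BilabelledGraph.{u} t where
  V := Quot (SeriesRel F F')
  finite := inferInstance
  graph := (F.graph.disjointUnion F'.graph).identify (SeriesRel F F')
  inLabel i := Quot.mk _ (.inl (F.inLabel i))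
  outLabel i := Quot.mk _ (.inr (F'.outLabel i))

/-- The identifications made by parallel composition: the `i`-th in-labels of `F` and `F'` with
each other, and likewise the `i`-th out-labels. -/
inductive ParallelRel (F F' : BilabelledGraph.{u} t) : F.V ⊕ F'.V → F.V ⊕ F'.V → Prop
  | glueIn (i : Fin t) : ParallelRel F F' (.inl (F.inLabel i)) (.inr (F'.inLabel i))
  | glueOut (i : Fin t) : ParallelRel F F' (.inl (F.outLabel i)) (.inr (F'.outLabel i))

/-- Parallel composition `F ⊙ F'`. -/
def parallel (F F' : BilabelledGraph.{u} t) : BilabelledGraph.{u} t where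
  V := Quot (ParallelRel F F')
  finite := inferInstance
  graph := (F.graph.disjointUnion F'.graph).identify (ParallelRel F F')
  inLabel i := Quot.mk _ (.inl (F.inLabel i))
  outLabel i := Quot.mk _ (.inl (F.outLabel i))

/-- The action of the symmetric group on the `2t` labels. The `2t` label positions are written as
`Fin t ⊕ Fin t`, the in-labels first. -/
def permute (σ : Equiv.Perm (Fin t ⊕ Fin t)) (F : BilabelledGraph.{u} t) :
    BilabelledGraph.{u} t where
  V := F.V
  finite := F.finite
  graph := F.graph
  inLabel i := Sum.elim F.inLabel F.outLabel (σ (.inl i))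
  outLabel i := Sum.elim F.inLabel F.outLabel (σ (.inr i))

/-- Membership in the class `𝓛_t` of `(t,t)`-bilabelled graphs: the class generated by the atomic
graphs under parallel composition with atomic graphs, series composition and the action of the
symmetric group on the labels. Bilabelled graphs are considered up to isomorphism. -/
inductive MemL (t : ℕ) : BilabelledGraph.{u} t → Prop
  | atomic (A : BilabelledGraph.{u} t) : A.IsAtomic → MemL t A
  | parallel (A F : BilabelledGraph.{u} t) : A.IsAtomic → MemL t F → MemL t (A.parallel F)
  | series (F F' : BilabelledGraph.{u} t) : MemL t F → MemL t F' → MemL t (F.series F')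
  | permute (σ : Equiv.Perm (Fin t ⊕ Fin t)) (F : BilabelledGraph.{u} t) :
      MemL t F → MemL t (F.permute σ)
  | iso (F F' : BilabelledGraph.{u} t) : F.IsIso F' → MemL t F → MemL t F'

/-- The expansion of a `(1,1)`-bilabelled graph `(F, u, v)`: a path of length two is added
between `u` and `v`. -/
def expansion (F : BilabelledGraph.{u} 1) : LoopGraph (Option F.V) :=
  F.graph.addPath (F.inLabel 0) (F.outLabel 0)

/-- The class `𝓞𝓟` of `(1,1)`-bilabelled graphs whose expansion is outerplanar. -/
def MemOP (F : BilabelledGraph.{u} 1) : Prop :=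
  F.expansion.IsOuterplanar

end BilabelledGraph

/-! The two inclusions rest on different descriptions of outerplanarity.

Every element of `𝓛₁` has a non-crossing layout on a line in which the in-label comes first and a
distinct out-label comes last (`MemL.hasLayout`). All operations preserve such layouts, and the new
vertex of the expansion can be placed behind everything else. In a non-crossing layout disjoint
connected sets never interleave, which rules out `K₄` and `K_{2,3}` as minors
(`Noncrossing.isOuterplanar`).

Conversely, `Admissible.inL` decomposes graphs by induction on the number of vertices. If `a ≠ b`
and the expansion is outerplanar, there are no two disjoint connected sets both joined to `a` and to
`b`: with the new vertex they would form a `K_{2,3}` between the poles `a` and `b`. Once the edge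
`ab` is set aside (parallel composition restores it), Menger's theorem separates `a` from `b` by at
most one vertex `c`, and the graph is a series composition. The expansions of the parts are minors
of `G + ab`, since the rest of the graph contracts to the required path.

If `a = b`, the graph is split at `a` when `G - a` is disconnected. Otherwise an isolated `a` is
split off, and any other `a` has a neighbour `b` without two disjoint connectors
(`exists_neighbor_not_hasConnectors`); the case of distinct labels applies to `(G, a, b)`, and the
out-label is then moved back to `a`. -/

namespace LoopGraph

/-! ### Connected sets and minors -/

variable {V : Type u} {V' : Type v}

/-- Preconnectedness of a vertex set: a non-empty subset that is closed under adjacency inside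
the set is the whole set. -/
def PConn (G : LoopGraph V) (A : Set V) : Prop :=
  ∀ S ⊆ A, S.Nonempty → (∀ x ∈ S, ∀ y ∈ A, G.Adj x y → y ∈ S) → A ⊆ S

/-- Closed subsets replace walks and subtypes from here on. Loops need no special treatment, as a
loop never leaves a set. -/
theorem connected_induce_iff (G : LoopGraph V) (A : Set V) :
    (G.deleteLoops.induce A).Connected ↔ A.Nonempty ∧ G.PConn A := by
  constructor
  · intro h
    refine ⟨Set.nonempty_coe_sort.1 h.nonempty, fun S hSA ⟨x, hx⟩ hS y hy => ?_⟩
    have hr := h.preconnected ⟨x, hSA hx⟩ ⟨y, hy⟩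
    rw [SimpleGraph.reachable_iff_reflTransGen] at hr
    have key : ∀ z : A, Relation.ReflTransGen (G.deleteLoops.induce A).Adj ⟨x, hSA hx⟩ z →
        (z : V) ∈ S := by
      intro z hz
      induction hz with
      | refl => exact hx
      | tail _ hbc ih => exact hS _ ih _ (Subtype.prop _) hbc.2
    exact key _ hr
  · rintro ⟨⟨x, hx⟩, h⟩
    rw [SimpleGraph.connected_iff_exists_forall_reachable]
    refine ⟨⟨x, hx⟩, fun y => ?_⟩
    have := h {z | ∃ hz : z ∈ A, (G.deleteLoops.induce A).Reachable ⟨x, hx⟩ ⟨z, hz⟩}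
      (fun z hz => hz.1) ⟨x, hx, SimpleGraph.Reachable.refl _⟩ ?_ y.2
    · exact this.2
    · rintro a ⟨ha, hr⟩ b hb hab
      refine ⟨hb, ?_⟩
      by_cases hne : a = b
      · subst hne; exact hr
      · exact hr.trans (SimpleGraph.Adj.reachable ⟨hne, hab⟩)

theorem PConn.singleton (G : LoopGraph V) (a : V) : G.PConn {a} := by
  rintro S hS ⟨x, hx⟩ -
  have := hS hx
  simp only [Set.mem_singleton_iff] at this
  subst this
  simpa using hx

theorem PConn.mono {G G' : LoopGraph V} {A : Set V} (hA : G.PConn A)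
    (h : ∀ x y, G.Adj x y → G'.Adj x y) : G'.PConn A :=
  fun S hS hne hcl => hA S hS hne fun x hx y hy hxy => hcl x hx y hy (h x y hxy)

/-- A connected set that meets a set closed under adjacency is contained in it. -/
theorem PConn.subset_of_closed {G : LoopGraph V} {A S : Set V} (hA : G.PConn A)
    (hne : (A ∩ S).Nonempty) (hcl : ∀ x ∈ A, x ∈ S → ∀ y ∈ A, G.Adj x y → y ∈ S) : A ⊆ S :=
  fun _ hx => (hA (A ∩ S) Set.inter_subset_left hne
    (fun x hx y hy hxy => ⟨hy, hcl x hx.1 hx.2 y hy hxy⟩) hx).2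

theorem PConn.exists_adj {G : LoopGraph V} {A S : Set V} (hA : G.PConn A)
    {x y : V} (hx : x ∈ A) (hxS : x ∈ S) (hy : y ∈ A) (hyS : y ∉ S) :
    ∃ a ∈ A, a ∈ S ∧ ∃ b ∈ A, b ∉ S ∧ G.Adj a b := by
  by_contra! h
  exact hyS (hA.subset_of_closed ⟨x, hx, hxS⟩
    (fun a ha haS b hb hab => by_contra fun hbS => h a ha haS b hb hbS hab) hy)

theorem PConn.union {G : LoopGraph V} {A B : Set V} (hA : G.PConn A) (hB : G.PConn B)
    (h : ∃ a ∈ A, ∃ b ∈ B, a = b ∨ G.Adj a b) : G.PConn (A ∪ B) := by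
  obtain ⟨a, ha, b, hb, hab⟩ := h
  intro S hS ⟨x, hx⟩ hcl
  have hAS : (∃ z ∈ A, z ∈ S) → A ⊆ S := fun ⟨z, hz, hzS⟩ =>
    hA.subset_of_closed ⟨z, hz, hzS⟩ fun p _ hpS q hq hpq => hcl p hpS q (.inl hq) hpq
  have hBS : (∃ z ∈ B, z ∈ S) → B ⊆ S := fun ⟨z, hz, hzS⟩ =>
    hB.subset_of_closed ⟨z, hz, hzS⟩ fun p _ hpS q hq hpq => hcl p hpS q (.inr hq) hpq
  have hiff : a ∈ S ↔ b ∈ S := by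
    rcases hab with rfl | hab
    · rfl
    · exact ⟨fun h => hcl a h b (.inr hb) hab, fun h => hcl b h a (.inl ha) (G.symm hab)⟩
  rcases hS hx with hxA | hxB
  · have h1 := hAS ⟨x, hxA, hx⟩
    exact Set.union_subset h1 (hBS ⟨b, hb, hiff.1 (h1 ha)⟩)
  · have h1 := hBS ⟨x, hxB, hx⟩
    exact Set.union_subset (hAS ⟨a, ha, hiff.2 (h1 hb)⟩) h1

theorem PConn.insert {G : LoopGraph V} {A : Set V} (hA : G.PConn A) {x : V}
    (h : A = ∅ ∨ ∃ a ∈ A, G.Adj a x) : G.PConn (insert x A) := by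
  rcases h with rfl | ⟨a, ha, hax⟩
  · simpa using PConn.singleton G x
  · rw [← Set.union_singleton]
    exact hA.union (PConn.singleton G x) ⟨a, ha, x, rfl, .inr hax⟩

/-- The connected component of `u` in the subgraph induced by `R`. -/
theorem exists_component (G : LoopGraph V) {R : Set V} {u : V} (hu : u ∈ R) :
    ∃ C ⊆ R, u ∈ C ∧ G.PConn C ∧ ∀ x ∈ C, ∀ y ∈ R, G.Adj x y → y ∈ C := by
  let P : Set (Set V) := {C | u ∈ C ∧ ∀ x ∈ C, ∀ y ∈ R, G.Adj x y → y ∈ C}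
  have hRP : R ∈ P := ⟨hu, fun _ _ _ hy _ => hy⟩
  have hIP : ⋂₀ P ∈ P :=
    ⟨fun C hC => hC.1, fun x hx y hy hxy C hC => hC.2 x (hx C hC) y hy hxy⟩
  refine ⟨⋂₀ P, Set.sInter_subset_of_mem hRP, hIP.1, ?_, hIP.2⟩
  intro S hS hne hcl
  by_cases huS : u ∈ S
  · refine Set.sInter_subset_of_mem ⟨huS, fun x hx y hy hxy => ?_⟩
    exact hcl x hx y (hIP.2 x (hS hx) y hy hxy) hxy
  -- By symmetry of adjacency the rest of the component is closed as well; containing `u`, it would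
  -- be a smaller member of `P`.
  · have : ⋂₀ P ⊆ ⋂₀ P \ S := by
      refine Set.sInter_subset_of_mem ⟨⟨hIP.1, huS⟩, fun x hx y hy hxy => ?_⟩
      exact ⟨hIP.2 x hx.1 y hy hxy, fun hyS => hx.2 (hcl y hyS x hx.1 (G.symm hxy))⟩
    obtain ⟨s, hs⟩ := hne
    exact absurd hs (this (hS hs)).2

theorem hasMinor_iff {W : Type*} (G : LoopGraph V) (H : SimpleGraph W) :
    G.HasMinor H ↔ ∃ B : W → Set V, (∀ a, (B a).Nonempty ∧ G.PConn (B a)) ∧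
      (∀ a b, a ≠ b → Disjoint (B a) (B b)) ∧
      (∀ a b, H.Adj a b → ∃ x ∈ B a, ∃ y ∈ B b, G.Adj x y) := by
  simp only [HasMinor, connected_induce_iff]

/-- Minors are transitive: if `G'` (up to loops) is a minor of `G`, minors of `G'` are minors
of `G`. -/
theorem HasMinor.trans {W : Type*} {G : LoopGraph V} {G' : LoopGraph V'} {H : SimpleGraph W}
    (h : G'.HasMinor H) {φ : V' → Set V} (hφ : ∀ a, (φ a).Nonempty ∧ G.PConn (φ a))
    (hdis : ∀ a b, a ≠ b → Disjoint (φ a) (φ b))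
    (hadj : ∀ a b, a ≠ b → G'.Adj a b → ∃ x ∈ φ a, ∃ y ∈ φ b, G.Adj x y) : G.HasMinor H := by
  rw [hasMinor_iff] at h ⊢
  obtain ⟨B, hB, hBd, hBa⟩ := h
  refine ⟨fun a => ⋃ v ∈ B a, φ v, fun a => ⟨?_, ?_⟩, fun a b hab => ?_, fun a b hab => ?_⟩
  · obtain ⟨v, hv⟩ := (hB a).1
    obtain ⟨x, hx⟩ := (hφ v).1
    exact ⟨x, Set.mem_biUnion hv hx⟩
  · intro S hS ⟨x, hx⟩ hcl
    have hsub : ∀ v ∈ B a, (∃ z ∈ φ v, z ∈ S) → φ v ⊆ S := fun v hv ⟨z, hz, hzS⟩ =>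
      (hφ v).2.subset_of_closed ⟨z, hz, hzS⟩ fun p _ hpS q hq hpq =>
        hcl p hpS q (Set.mem_biUnion hv hq) hpq
    obtain ⟨v, hv, hxv⟩ := Set.mem_iUnion₂.1 (hS hx)
    refine Set.iUnion₂_subset fun w hw => ?_
    refine (hB a).2.subset_of_closed (S := {w | φ w ⊆ S}) ⟨v, hv, hsub v hv ⟨x, hxv, hx⟩⟩ ?_ hw
    intro p hp hpS q hq hpq
    by_cases hne : p = q
    · exact hne ▸ hpS
    · obtain ⟨s, hs, t, ht, hst⟩ := hadj p q hne hpq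
      exact hsub q hq ⟨t, ht, hcl s (hpS hs) t (Set.mem_biUnion hq ht) hst⟩
  · simp only [Set.disjoint_iUnion_left, Set.disjoint_iUnion_right]
    intro p hp q hq
    exact hdis _ _ fun h => Set.disjoint_left.1 (hBd a b hab) hq (h ▸ hp)
  · obtain ⟨p, hp, q, hq, hpq⟩ := hBa a b hab
    have hne : p ≠ q := fun h => by
      subst h
      exact Set.disjoint_left.1 (hBd a b hab.ne) hp hq
    obtain ⟨s, hs, t, ht, hst⟩ := hadj p q hne hpq
    exact ⟨s, Set.mem_biUnion hp hs, t, Set.mem_biUnion hq ht, hst⟩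

theorem IsOuterplanar.of_minor {G : LoopGraph V} {G' : LoopGraph V'} (h : G.IsOuterplanar)
    {φ : V' → Set V} (hφ : ∀ a, (φ a).Nonempty ∧ G.PConn (φ a))
    (hdis : ∀ a b, a ≠ b → Disjoint (φ a) (φ b))
    (hadj : ∀ a b, a ≠ b → G'.Adj a b → ∃ x ∈ φ a, ∃ y ∈ φ b, G.Adj x y) : G'.IsOuterplanar :=
  ⟨fun h' => h.1 (h'.trans hφ hdis hadj), fun h' => h.2 (h'.trans hφ hdis hadj)⟩

theorem IsOuterplanar.of_injective {G : LoopGraph V} {G' : LoopGraph V'} (h : G.IsOuterplanar)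
    {f : V' → V} (hf : Function.Injective f) (hadj : ∀ a b, G'.Adj a b → G.Adj (f a) (f b)) :
    G'.IsOuterplanar :=
  h.of_minor (φ := fun a => {f a}) (fun a => ⟨⟨_, rfl⟩, PConn.singleton _ _⟩)
    (fun _ _ hab => by simpa using fun h => hab (hf h))
    (fun a b _ hab => ⟨_, rfl, _, rfl, hadj a b hab⟩)

/-! ### Non-crossing layouts exclude `K₄` and `K_{2,3}` -/

/-- No two edges cross if the vertices are placed on a line according to `f`. -/
def Noncrossing (G : LoopGraph V) (f : V → ℤ) : Prop :=
  ∀ x y z w, G.Adj x y → G.Adj z w → ¬ (f x < f z ∧ f z < f y ∧ f y < f w)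

/-- In a non-crossing layout, disjoint connected sets do not interleave. -/
theorem Noncrossing.not_interleave {G : LoopGraph V} {f : V → ℤ} (hnc : G.Noncrossing f)
    (hf : Function.Injective f) {A B : Set V} (hA : G.PConn A) (hB : G.PConn B)
    (hAB : Disjoint A B) {a₁ a₂ b₁ b₂ : V} (ha₁ : a₁ ∈ A) (ha₂ : a₂ ∈ A) (hb₁ : b₁ ∈ B)
    (hb₂ : b₂ ∈ B) : ¬ (f a₁ < f b₁ ∧ f b₁ < f a₂ ∧ f a₂ < f b₂) := by
  rintro ⟨h1, h2, h3⟩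
  have hne : ∀ a ∈ A, ∀ b ∈ B, f a ≠ f b := fun a ha b hb h =>
    Set.disjoint_left.1 hAB ha (hf h ▸ hb)
  -- Some edge of `A` leaves the interval between `b₁` and `b₂`, so exactly one of `b₁`, `b₂` lies
  -- between its ends. By `key`, an edge of `B` then has to cross it.
  obtain ⟨a, ha, ⟨haS1, haS2⟩, a', ha', haS', haa⟩ :=
    hA.exists_adj (S := {y | f b₁ < f y ∧ f y < f b₂}) ha₂ ⟨h2, h3⟩ ha₁ (fun h => by
      have := h.1; omega)
  have n1 := hne a' ha' b₁ hb₁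
  have n2 := hne a' ha' b₂ hb₂
  simp only [Set.mem_ofPred_eq, not_and, not_lt] at haS'
  have key : ∀ p q : V, p ∈ A → q ∈ A → G.Adj p q → f p < f q → ∀ x ∈ B, ∀ y ∈ B,
      f p < f x → f x < f q → (f y < f p ∨ f q < f y) → False := by
    intro p q hp hq hpq _ x hx y hy h1 h2 h3
    obtain ⟨b, hb, ⟨c1, c2⟩, b', hb', hbS', hbb⟩ :=
      hB.exists_adj (S := {y | f p < f y ∧ f y < f q}) hx ⟨h1, h2⟩ hy (fun h => by
        have := h.1; have := h.2; omega)
    have n1 := hne p hp b' hb'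
    have n2 := hne q hq b' hb'
    simp only [Set.mem_ofPred_eq, not_and, not_lt] at hbS'
    by_cases hlt : f p < f b'
    · exact hnc p q b b' hpq hbb ⟨c1, c2, by have := hbS' hlt; omega⟩
    · exact hnc b' b p q (G.symm hbb) hpq ⟨by omega, c1, c2⟩
  by_cases hlt : f b₁ < f a'
  · have := haS' hlt
    exact key a a' ha ha' haa (by omega) b₂ hb₂ b₁ hb₁ haS2 (by omega) (.inl haS1)
  · exact key a' a ha' ha (G.symm haa) (by omega) b₁ hb₁ b₂ hb₂ (by omega) haS1 (.inr haS2)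

/-- One representative per branch set orders the vertices of the minor. The branch sets of two
disjoint edges have disjoint connected unions, so these edges do not cross. But four points in order
give crossing edges in `K₄`, and in `K_{2,3}` two of the three points share an arc between the
poles. -/
theorem Noncrossing.isOuterplanar {G : LoopGraph V} {f : V → ℤ} (hnc : G.Noncrossing f)
    (hf : Function.Injective f) : G.IsOuterplanar := by
  have key : ∀ {W : Type} (H : SimpleGraph W), G.HasMinor H → ∃ g : W → ℤ,
      Function.Injective g ∧ ∀ a b c d, H.Adj a b → H.Adj c d → a ≠ c → a ≠ d → b ≠ c → b ≠ d →
        ¬ (g a < g c ∧ g c < g b ∧ g b < g d) := by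
    intro W H h
    obtain ⟨B, hB, hBd, hBa⟩ := (hasMinor_iff _ _).1 h
    choose p hp using fun a => (hB a).1
    refine ⟨fun a => f (p a), fun a b hab => ?_, fun a b c d hab hcd h1 h2 h3 h4 => ?_⟩
    · by_contra hne
      exact Set.disjoint_left.1 (hBd a b hne) (hp a) (hf hab ▸ hp b)
    · have hu : ∀ a b, H.Adj a b → G.PConn (B a ∪ B b) := fun a b hab => by
        obtain ⟨x, hx, y, hy, hxy⟩ := hBa a b hab
        exact (hB a).2.union (hB b).2 ⟨x, hx, y, hy, .inr hxy⟩
      refine hnc.not_interleave hf (hu a b hab) (hu c d hcd) ?_ (.inl (hp a)) (.inr (hp b))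
        (.inl (hp c)) (.inr (hp d))
      simp only [Set.disjoint_union_left, Set.disjoint_union_right]
      exact ⟨⟨hBd _ _ h1, hBd _ _ h3⟩, hBd _ _ h2, hBd _ _ h4⟩
  constructor
  · intro h
    obtain ⟨g, hg, hcr⟩ := key _ h
    have hm : StrictMono (g ∘ Tuple.sort g) :=
      (Tuple.monotone_sort g).strictMono_of_injective (hg.comp (Equiv.injective _))
    have hi := (Tuple.sort g).injective
    refine hcr (Tuple.sort g 0) (Tuple.sort g 2) (Tuple.sort g 1) (Tuple.sort g 3) ?_ ?_ ?_ ?_ ?_ ?_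
      ⟨hm (by decide : (0 : Fin 4) < 1), hm (by decide : (1 : Fin 4) < 2),
        hm (by decide : (2 : Fin 4) < 3)⟩
    all_goals simp [hi.eq_iff]
  · intro h
    obtain ⟨g, hg, hcr⟩ := key _ h
    have hpq : g (.inl 0) ≠ g (.inl 1) := hg.ne (by simp)
    have hpi : ∀ k i, g (.inl k) ≠ g (.inr i) := fun k i => hg.ne (by simp)
    have hij : ∀ i j, i ≠ j → g (.inr i) ≠ g (.inr j) := fun i j h => hg.ne (by simpa using h)
    -- Up to exchanging `i` and `j`, these are the orders in which both lie on the same arc between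
    -- the poles `k` and `l`; everything outside the interval from `k` to `l` counts as one arc.
    have hc : ∀ k l i j, k ≠ l → i ≠ j →
        ¬ (g (.inl k) < g (.inl l) ∧ g (.inl l) < g (.inr i) ∧ g (.inr i) < g (.inr j)) ∧
        ¬ (g (.inl k) < g (.inr j) ∧ g (.inr j) < g (.inr i) ∧ g (.inr i) < g (.inl l)) ∧
        ¬ (g (.inr j) < g (.inl k) ∧ g (.inl k) < g (.inl l) ∧ g (.inl l) < g (.inr i)) ∧
        ¬ (g (.inr i) < g (.inr j) ∧ g (.inr j) < g (.inl k) ∧ g (.inl k) < g (.inl l)) := by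
      intro k l i j hkl hij
      exact ⟨hcr _ _ _ _ (by simp) (by simp) (by simpa) (by simp) (by simp) (by simpa using hij),
        hcr _ _ _ _ (by simp) (by simp) (by simp) (by simpa) (by simpa using hij) (by simp),
        hcr _ _ _ _ (by simp) (by simp) (by simp) (by simpa using hij.symm)
          (by simpa using hkl.symm) (by simp),
        hcr _ _ _ _ (by simp) (by simp) (by simpa using hij) (by simp) (by simp) (by simpa)⟩
    /- Two of the three points lie on the same arc between the two poles. -/
    have harc : ∀ k l, k ≠ l → g (.inl k) < g (.inl l) → False := by
      intro k l hkl hlt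
      have h2 : ∀ i j, i ≠ j →
          ((g (.inl k) < g (.inr i) ∧ g (.inr i) < g (.inl l)) ↔
            ¬ (g (.inl k) < g (.inr j) ∧ g (.inr j) < g (.inl l))) := by
        intro i j h
        have c1 := hc k l i j hkl h
        have c2 := hc k l j i hkl h.symm
        have d1 := hij i j h
        have d2 := hpi k i
        have d3 := hpi k j
        have d4 := hpi l i
        have d5 := hpi l j
        omega
      have e1 := h2 0 1 (by decide)
      have e2 := h2 1 2 (by decide)
      have e3 := h2 0 2 (by decide)
      tauto
    rcases lt_or_gt_of_ne hpq with h | h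
    · exact harc _ _ (by decide) h
    · exact harc _ _ (by decide) h

end LoopGraph

/-! ### Layouts with the labels at the ends: `𝓛₁` is contained in `𝓞𝓟` -/

namespace LoopGraph

variable {V : Type u} {V' : Type v}

/-- A non-crossing layout of `G` on a line with `a` as first and, if `a ≠ b`, `b` as last
vertex. -/
def HasLayout (G : LoopGraph V) (a b : V) : Prop :=
  ∃ f : V → ℤ, Function.Injective f ∧ G.Noncrossing f ∧ (∀ x, f a ≤ f x) ∧
    (a ≠ b → ∀ x, f x ≤ f b)

theorem HasLayout.symm {G : LoopGraph V} {a b : V} (h : G.HasLayout a b) : G.HasLayout b a := by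
  by_cases hab : a = b
  · exact hab ▸ h
  obtain ⟨f, hf, hnc, ha, hb⟩ := h
  refine ⟨fun x => - f x, fun x y hxy => hf (neg_injective hxy),
    fun x y z w hxy hzw => ?_, fun x => neg_le_neg (hb hab x), fun _ x => neg_le_neg (ha x)⟩
  have := hnc w z y x (G.symm hzw) (G.symm hxy)
  simp only [neg_lt_neg_iff]
  tauto

/-- The new vertex goes behind all others. Its edges end at `a` or `b`, which are extreme in the
layout and hence not strictly between the ends of any edge. -/
theorem HasLayout.isOuterplanar_addPath [Finite V] {G : LoopGraph V} {a b : V}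
    (h : G.HasLayout a b) : (G.addPath a b).IsOuterplanar := by
  obtain ⟨f, hf, hnc, ha, hb⟩ := h
  obtain ⟨M, hM⟩ := (Set.finite_range f).bddAbove
  replace hM : ∀ x, f x ≤ M := fun x => hM ⟨x, rfl⟩
  have hab : ∀ x, x = a ∨ x = b → (∀ y, f x ≤ f y) ∨ (∀ y, f y ≤ f x) := by
    intro x hx
    by_cases h : a = b
    · subst h
      simp only [or_self] at hx
      exact .inl (hx ▸ ha)
    · rcases hx with rfl | rfl
      · exact .inl ha
      · exact .inr (hb h)
  refine Noncrossing.isOuterplanar (f := fun o => o.elim (M + 1) f) ?_ ?_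
  · rintro (_ | x) (_ | y) (_ | z) (_ | w) hxy hzw ⟨h1, h2, h3⟩ <;>
      simp only [Option.elim, addPath] at h1 h2 h3 hxy hzw
    all_goals try have hx := hM x
    all_goals try have hy := hM y
    all_goals try have hz := hM z
    all_goals try have hw := hM w
    all_goals try omega
    · have := hab z hzw
      rcases this with h | h
      · have := h x; omega
      · have := h y; omega
    · exact hnc x y z w hxy hzw ⟨h1, h2, h3⟩
  · rintro (_ | x) (_ | y) hxy <;> simp only [Option.elim] at hxy
    · rfl
    · have := hM y; omega
    · have := hM x; omega
    · rw [hf hxy]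

/-- A layout of a quotient is given by a function on the representatives. -/
theorem HasLayout.identify {W : Type*} {G : LoopGraph W} {r : W → W → Prop} {a b : W} (h : W → ℤ)
    (hr : ∀ s t, r s t → h s = h t) (hinj : ∀ s t, h s = h t → Quot.mk r s = Quot.mk r t)
    (hnc : G.Noncrossing h) (ha : ∀ x, h a ≤ h x)
    (hb : Quot.mk r a ≠ Quot.mk r b → ∀ x, h x ≤ h b) :
    (G.identify r).HasLayout (Quot.mk r a) (Quot.mk r b) := by
  refine ⟨Quot.lift h hr, ?_, ?_, ?_, ?_⟩
  · rintro ⟨s⟩ ⟨t⟩ hst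
    exact hinj s t hst
  · rintro _ _ _ _ ⟨x, y, rfl, rfl, hxy⟩ ⟨z, w, rfl, rfl, hzw⟩
    exact hnc x y z w hxy hzw
  · rintro ⟨x⟩
    exact ha x
  · rintro hne ⟨x⟩
    exact hb hne x

end LoopGraph

namespace BilabelledGraph

open LoopGraph

/-- The two layouts are concatenated. The exceptional case is `F` with distinct labels and `F'` with
equal ones: there the glued vertex is the out-label and has to remain last. -/
theorem hasLayout_series (F F' : BilabelledGraph.{u} 1)
    (h : F.graph.HasLayout (F.inLabel 0) (F.outLabel 0))
    (h' : F'.graph.HasLayout (F'.inLabel 0) (F'.outLabel 0)) :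
    (F.series F').graph.HasLayout ((F.series F').inLabel 0) ((F.series F').outLabel 0) := by
  classical
  obtain ⟨f, hf, hnc, ha, hb⟩ := h
  obtain ⟨f', hf', hnc', ha', hb'⟩ := h'
  have glue : Quot.mk (SeriesRel F F') (.inl (F.outLabel 0)) = Quot.mk _ (.inr (F'.inLabel 0)) :=
    Quot.sound (SeriesRel.glue 0)
  obtain ⟨M, hM⟩ := (Set.finite_range f).bddAbove
  replace hM : ∀ x, f x ≤ M := fun x => hM ⟨x, rfl⟩
  obtain ⟨N, hN⟩ := (Set.finite_range f').bddAbove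
  replace hN : ∀ x, f' x ≤ N := fun x => hN ⟨x, rfl⟩
  have hlt' : ∀ x, x ≠ F'.inLabel 0 → f' (F'.inLabel 0) < f' x := fun x hx =>
    lt_of_le_of_ne (ha' x) fun h => hx (hf' h.symm)
  by_cases hc : F.inLabel 0 ≠ F.outLabel 0 ∧ F'.inLabel 0 = F'.outLabel 0
  · /- The second graph is put in reverse order before the last vertex of the first graph. -/
    have hlt : ∀ x, x ≠ F.outLabel 0 → f x < f (F.outLabel 0) := fun x hx =>
      lt_of_le_of_ne (hb hc.1 x) fun h => hx (hf h)
    -- Since `f' ≤ N`, the reversed layout `K - f'` lies strictly beyond the bound `M` of `f`. The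
    -- glued vertex moves to `K - f' (F'.inLabel 0)`, the largest value used.
    set K := M + N + 1
    let h : F.V ⊕ F'.V → ℤ := Sum.elim
      (fun x => if x = F.outLabel 0 then K - f' (F'.inLabel 0) else f x) (fun x => K - f' x)
    refine HasLayout.identify h ?_ ?_ ?_ ?_ ?_
    · rintro _ _ ⟨i⟩
      simp [h, Subsingleton.elim i 0]
    all_goals
      have hl : ∀ x, h (.inl x) = if x = F.outLabel 0 then K - f' (F'.inLabel 0) else f x :=
        fun _ => rfl
      have hr : ∀ x, h (.inr x) = K - f' x := fun _ => rfl
      have hl' : ∀ x, (x = F.outLabel 0 ∧ h (.inl x) = K - f' (F'.inLabel 0)) ∨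
          (h (.inl x) ≤ M ∧ x ≠ F.outLabel 0 ∧ h (.inl x) = f x) := fun x => by
        by_cases hx : x = F.outLabel 0
        · exact .inl ⟨hx, by rw [hl, if_pos hx]⟩
        · exact .inr ⟨by rw [hl, if_neg hx]; exact hM x, hx, by rw [hl, if_neg hx]⟩
    · rintro (x | x) (y | y) hxy
      · congr 2
        have hN := hN (F'.inLabel 0)
        rcases hl' x with ⟨hx, hx'⟩ | ⟨hx, hx', hx''⟩ <;>
          rcases hl' y with ⟨hy, hy'⟩ | ⟨hy, hy', hy''⟩
        · rw [hx, hy]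
        · omega
        · omega
        · exact hf (by omega)
      · have hN := hN y
        rcases hl' x with ⟨hx, hx'⟩ | ⟨hx, hx', hx''⟩
        · rw [hx, glue, hf' (by have := hr y; omega : f' y = f' (F'.inLabel 0))]
        · have := hr y; omega
      · have hN := hN x
        rcases hl' y with ⟨hx, hx'⟩ | ⟨hx, hx', hx''⟩
        · rw [hx, glue, hf' (by have := hr x; omega : f' x = f' (F'.inLabel 0))]
        · have := hr x; omega
      · rw [hr, hr] at hxy
        rw [hf' (by omega : f' x = f' y)]
    · rintro _ _ _ _ (@⟨x, y, hxy⟩ | @⟨x, y, hxy⟩) (@⟨z, w, hzw⟩ | @⟨z, w, hzw⟩) ⟨h1, h2, h3⟩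
      · have hmono : ∀ p q, h (.inl p) < h (.inl q) → f p < f q := by
          intro p q hpq
          have := hN (F'.inLabel 0)
          rcases hl' p with ⟨hx, hx'⟩ | ⟨hx, hx', hx''⟩ <;>
            rcases hl' q with ⟨hy, hy'⟩ | ⟨hy, hy', hy''⟩
          · omega
          · omega
          · rw [hy]; exact hlt p hx'
          · omega
        exact hnc x y z w hxy hzw ⟨hmono _ _ h1, hmono _ _ h2, hmono _ _ h3⟩
      · have := hr z
        have := hr w
        have := hN z
        have := ha' w
        rcases hl' y with ⟨hx, hx'⟩ | ⟨hx, hx', hx''⟩ <;> omega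
      · have := hr x
        have := hr y
        have := hN x
        have := ha' y
        rcases hl' z with ⟨hx, hx'⟩ | ⟨hx, hx', hx''⟩ <;> omega
      · refine hnc' w z y x (F'.graph.symm hzw) (F'.graph.symm hxy) ?_
        simp only [hr] at h1 h2 h3
        omega
    · have h0 := hl' (F.inLabel 0)
      have h1 : F.inLabel 0 ≠ F.outLabel 0 := hc.1
      rintro (x | x)
      · have := hM (F.inLabel 0)
        have := hN (F'.inLabel 0)
        have := ha x
        rcases hl' x with ⟨hx, hx'⟩ | ⟨hx, hx', hx''⟩ <;> grind
      · have := hN x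
        have := hr x
        grind
    · intro _
      rw [← hc.2]
      rintro (x | x)
      · have := hN (F'.inLabel 0)
        have := hr (F'.inLabel 0)
        rcases hl' x with ⟨hx, hx'⟩ | ⟨hx, hx', hx''⟩ <;> omega
      · have := ha' x
        have := hr x
        have := hr (F'.inLabel 0)
        omega
  -- The second graph, except for its in-label, follows the first. The glued vertex is first or last
  -- in the layout of `F`, so no edge of `F` passes over it.
  · let h : F.V ⊕ F'.V → ℤ := Sum.elim f
      (fun x => if x = F'.inLabel 0 then f (F.outLabel 0) else M + f' x - f' (F'.inLabel 0))
    refine HasLayout.identify h ?_ ?_ ?_ ?_ ?_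
    · rintro _ _ ⟨i⟩
      simp [h, Subsingleton.elim i 0]
    all_goals
      have hl : ∀ x, h (.inl x) = f x := fun _ => rfl
      have hr : ∀ x, h (.inr x) = if x = F'.inLabel 0 then f (F.outLabel 0) else
        M + f' x - f' (F'.inLabel 0) := fun _ => rfl
      have hr' : ∀ x, (x = F'.inLabel 0 ∧ h (.inr x) = f (F.outLabel 0)) ∨
          (M < h (.inr x) ∧ x ≠ F'.inLabel 0 ∧ h (.inr x) = M + f' x - f' (F'.inLabel 0)) :=
        fun x => by
          by_cases hx : x = F'.inLabel 0
          · exact .inl ⟨hx, by rw [hr, if_pos hx]⟩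
          · have := hlt' x hx
            have := hr x
            rw [if_neg hx] at this
            exact .inr ⟨by omega, hx, this⟩
      have hv : (∀ x, f (F.outLabel 0) ≤ f x) ∨ (∀ x, f x ≤ f (F.outLabel 0)) := by
        by_cases h : F.inLabel 0 = F.outLabel 0
        · exact .inl (h ▸ ha)
        · exact .inr (hb h)
      have hMv := hM (F.outLabel 0)
    · rintro (x | x) (y | y) hxy
      · rw [hf (hl x ▸ hl y ▸ hxy : f x = f y)]
      · have := hM x
        have := hl x
        rcases hr' y with ⟨hy, hy'⟩ | ⟨hy, hy', hy''⟩
        · rw [hy, ← glue, hf (by omega : f x = f (F.outLabel 0))]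
        · omega
      · have := hM y
        have := hl y
        rcases hr' x with ⟨hy, hy'⟩ | ⟨hy, hy', hy''⟩
        · rw [hy, ← glue, hf (by omega : f y = f (F.outLabel 0))]
        · omega
      · congr 2
        rcases hr' x with ⟨hx, hx'⟩ | ⟨hx, hx', hx''⟩ <;>
          rcases hr' y with ⟨hy, hy'⟩ | ⟨hy, hy', hy''⟩
        · rw [hx, hy]
        · omega
        · omega
        · exact hf' (by omega)
    · rintro _ _ _ _ (@⟨x, y, hxy⟩ | @⟨x, y, hxy⟩) (@⟨z, w, hzw⟩ | @⟨z, w, hzw⟩) ⟨h1, h2, h3⟩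
      · exact hnc x y z w hxy hzw ⟨h1, h2, h3⟩
      · rw [hl] at h1 h2
        have := hM y
        rcases hr' z with ⟨hx, hx'⟩ | ⟨hx, hx', hx''⟩
        · rcases hv with hv | hv
          · have := hv x; omega
          · have := hv y; omega
        · omega
      · rw [hl] at h1 h2 h3
        have := hM w
        rcases hr' x with ⟨hx, hx'⟩ | ⟨hx, hx', hx''⟩ <;>
          rcases hr' y with ⟨hy, hy'⟩ | ⟨hy, hy', hy''⟩ <;> omega
      · have hmono : ∀ p q, h (.inr p) < h (.inr q) → f' p < f' q := by
          intro p q hpq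
          rcases hr' p with ⟨hx, hx'⟩ | ⟨hx, hx', hx''⟩ <;>
            rcases hr' q with ⟨hy, hy'⟩ | ⟨hy, hy', hy''⟩
          · omega
          · rw [hx]; exact hlt' q hy'
          · omega
          · omega
        exact hnc' x y z w hxy hzw ⟨hmono _ _ h1, hmono _ _ h2, hmono _ _ h3⟩
    · rintro (x | x)
      · exact ha x
      · have := hM (F.inLabel 0)
        have := ha (F.outLabel 0)
        have := hl (F.inLabel 0)
        rcases hr' x with ⟨hx, hx'⟩ | ⟨hx, hx', hx''⟩ <;> omega
    · intro hne
      have hne' : F'.inLabel 0 ≠ F'.outLabel 0 := by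
        intro h'
        refine hc ⟨fun h => hne ?_, h'⟩
        rw [h, ← h', glue]
      have h0 := hr' (F'.outLabel 0)
      rintro (x | x)
      · have := hM x
        have := hl x
        grind
      · have := hb' hne' x
        rcases hr' x with ⟨hx, hx'⟩ | ⟨hx, hx', hx''⟩ <;> grind

theorem IsAtomic.eq_or {A : BilabelledGraph.{u} 1} (hA : A.IsAtomic) (x : A.V) :
    x = A.inLabel 0 ∨ x = A.outLabel 0 :=
  (hA x).imp (fun ⟨i, hi⟩ => by rw [← hi, Subsingleton.elim i 0])
    (fun ⟨i, hi⟩ => by rw [← hi, Subsingleton.elim i 0])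

/-- Edges of `A` join extreme positions and cross nothing. If `A` has a single vertex, the labels of
`F` merge: the last vertex moves onto the first, which creates no crossing because both are extreme.
-/
theorem hasLayout_parallel (A F : BilabelledGraph.{u} 1) (hA : A.IsAtomic)
    (h : F.graph.HasLayout (F.inLabel 0) (F.outLabel 0)) :
    (A.parallel F).graph.HasLayout ((A.parallel F).inLabel 0) ((A.parallel F).outLabel 0) := by
  classical
  obtain ⟨f, hf, hnc, ha, hb⟩ := h
  have glueIn : Quot.mk (ParallelRel A F) (.inl (A.inLabel 0)) = Quot.mk _ (.inr (F.inLabel 0)) :=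
    Quot.sound (ParallelRel.glueIn 0)
  have glueOut : Quot.mk (ParallelRel A F) (.inl (A.outLabel 0)) =
      Quot.mk _ (.inr (F.outLabel 0)) := Quot.sound (ParallelRel.glueOut 0)
  let h : A.V ⊕ F.V → ℤ := Sum.elim
    (fun x => if x = A.inLabel 0 then f (F.inLabel 0) else f (F.outLabel 0))
    (fun x => if x = F.outLabel 0 ∧ A.inLabel 0 = A.outLabel 0 then f (F.inLabel 0) else f x)
  have hl : ∀ x, (x = A.inLabel 0 ∧ h (.inl x) = f (F.inLabel 0)) ∨
      (x = A.outLabel 0 ∧ A.inLabel 0 ≠ A.outLabel 0 ∧ h (.inl x) = f (F.outLabel 0)) := by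
    intro x
    by_cases hx : x = A.inLabel 0
    · exact .inl ⟨hx, if_pos hx⟩
    · have := (hA.eq_or x).resolve_left hx
      exact .inr ⟨this, fun h => hx (h ▸ this), if_neg hx⟩
  have hr : ∀ x, (x = F.outLabel 0 ∧ A.inLabel 0 = A.outLabel 0 ∧
      h (.inr x) = f (F.inLabel 0)) ∨
      ((x = F.outLabel 0 → A.inLabel 0 ≠ A.outLabel 0) ∧ h (.inr x) = f x) := by
    intro x
    by_cases hx : x = F.outLabel 0 ∧ A.inLabel 0 = A.outLabel 0
    · exact .inl ⟨hx.1, hx.2, if_pos hx⟩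
    · exact .inr ⟨fun h h' => hx ⟨h, h'⟩, if_neg hx⟩
  have hrep : ∀ s, ∃ x, Quot.mk (ParallelRel A F) s = Quot.mk _ (.inr x) ∧ h s = f x := by
    rintro (x | x)
    · rcases hl x with ⟨hx, hx'⟩ | ⟨hx, -, hx'⟩
      · exact ⟨_, by rw [hx, glueIn], hx'⟩
      · exact ⟨_, by rw [hx, glueOut], hx'⟩
    · rcases hr x with ⟨hx, hx', hx''⟩ | ⟨-, hx⟩
      · exact ⟨_, by rw [hx, ← glueOut, ← hx', glueIn], hx''⟩
      · exact ⟨x, rfl, hx⟩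
  have hmin : ∀ s, f (F.inLabel 0) ≤ h s := fun s => by
    obtain ⟨x, -, hx⟩ := hrep s
    exact hx ▸ ha x
  have hmax : F.inLabel 0 = F.outLabel 0 ∨ ∀ s, h s ≤ f (F.outLabel 0) := by
    refine or_iff_not_imp_left.2 fun hne s => ?_
    obtain ⟨x, -, hx⟩ := hrep s
    exact hx ▸ hb hne x
  refine HasLayout.identify h ?_ ?_ ?_ ?_ ?_
  · rintro _ _ (i | i) <;> rw [Subsingleton.elim i 0]
    · have h1 := hl (A.inLabel 0)
      have h2 := hr (F.inLabel 0)
      grind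
    · have h1 := hl (A.outLabel 0)
      have h2 := hr (F.outLabel 0)
      grind
  · intro s t hst
    obtain ⟨x, hx, hx'⟩ := hrep s
    obtain ⟨y, hy, hy'⟩ := hrep t
    rw [hx, hy, hf (hx' ▸ hy' ▸ hst : f x = f y)]
  · rintro _ _ _ _ (@⟨x, y, hxy⟩ | @⟨x, y, hxy⟩) (@⟨z, w, hzw⟩ | @⟨z, w, hzw⟩) ⟨h1, h2, h3⟩
    · have hx := hl x
      have hy := hl y
      have hz := hl z
      grind
    · have hx := hl x
      have hy := hl y
      have hw := hmin (.inr w)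
      have hz := hmin (.inr z)
      rcases hmax with hm | hm
      · grind
      · have := hm (.inr w)
        grind
    · have hz := hl z
      have hw := hl w
      have hx := hmin (.inr x)
      grind
    · have hx := hr x
      have hy := hr y
      have hz := hr z
      have hw := hr w
      have h0 := hmin (.inr x)
      have c1 := hnc x y z w hxy hzw
      have c2 := hnc z w y x hzw (F.graph.symm hxy)
      by_cases hne : F.inLabel 0 = F.outLabel 0
      · grind
      · have := hb hne w
        have hwv : f w = f (F.outLabel 0) → w = F.outLabel 0 := fun h => hf h
        grind
  · intro s
    have := hl (A.inLabel 0)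
    have := hmin s
    grind
  · intro hne s
    have h1 := hl (A.outLabel 0)
    have h2 : A.inLabel 0 ≠ A.outLabel 0 := fun h => hne (by rw [h])
    have h3 : F.inLabel 0 ≠ F.outLabel 0 := fun h => hne (by rw [glueIn, glueOut, h])
    have := (hmax.resolve_left h3) s
    grind

theorem IsAtomic.hasLayout {A : BilabelledGraph.{u} 1} (hA : A.IsAtomic) :
    A.graph.HasLayout (A.inLabel 0) (A.outLabel 0) := by
  classical
  have h0 : ∀ x, (if x = A.inLabel 0 then (0 : ℤ) else 1) = 0 ∨
      (if x = A.inLabel 0 then (0 : ℤ) else 1) = 1 := fun x => by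
    split_ifs <;> simp
  refine ⟨fun x => if x = A.inLabel 0 then 0 else 1, fun x y hxy => ?_, ?_, ?_, ?_⟩
  · have hx := hA.eq_or x
    have hy := hA.eq_or y
    grind
  · intro x y z w _ _
    have := h0 x
    have := h0 y
    have := h0 z
    have := h0 w
    grind
  · intro x
    grind
  · intro hne x
    grind

theorem hasLayout_permute (σ : Equiv.Perm (Fin 1 ⊕ Fin 1)) (F : BilabelledGraph.{u} 1)
    (h : F.graph.HasLayout (F.inLabel 0) (F.outLabel 0)) :
    (F.permute σ).graph.HasLayout ((F.permute σ).inLabel 0) ((F.permute σ).outLabel 0) := by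
  have hne : σ (.inl 0) ≠ σ (.inr 0) := σ.injective.ne (by simp)
  simp only [permute]
  generalize σ (.inl 0) = p at *
  generalize σ (.inr 0) = q at *
  rcases p with i | i <;> rcases q with j | j <;>
    rw [Subsingleton.elim i 0, Subsingleton.elim j 0] at *
  · exact absurd rfl hne
  · exact h
  · exact h.symm
  · exact absurd rfl hne

theorem MemL.hasLayout {F : BilabelledGraph.{u} 1} (h : MemL 1 F) :
    F.graph.HasLayout (F.inLabel 0) (F.outLabel 0) := by
  induction h with
  | atomic A hA => exact hA.hasLayout
  | parallel A F hA _ ih => exact hasLayout_parallel A F hA ih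
  | series F F' _ _ ih ih' => exact hasLayout_series F F' ih ih'
  | permute σ F _ ih => exact hasLayout_permute σ F ih
  | iso F F' hiso _ ih =>
    obtain ⟨e, hin, hout⟩ := hiso
    obtain ⟨f, hf, hnc, ha, hb⟩ := ih
    have hi : e.symm (F'.inLabel 0) = F.inLabel 0 := by simp [← hin]
    have ho : e.symm (F'.outLabel 0) = F.outLabel 0 := by simp [← hout]
    refine ⟨fun x => f (e.symm x), hf.comp e.symm.injective, fun x y z w hxy hzw => ?_,
      fun x => ?_, fun hne x => ?_⟩
    · exact hnc _ _ _ _ (e.symm.map_rel_iff.2 hxy) (e.symm.map_rel_iff.2 hzw)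
    · beta_reduce; rw [hi]; exact ha _
    · beta_reduce; rw [ho]
      exact hb (fun h => hne (by rw [← hin, ← hout, h])) _

theorem MemL.memOP {F : BilabelledGraph.{u} 1} (h : MemL 1 F) : F.MemOP :=
  h.hasLayout.isOuterplanar_addPath

end BilabelledGraph

/-! ### Recognising members of `𝓛₁` without quotients -/

namespace LoopGraph

variable {V : Type u} {V' : Type v}

/-- The subgraph induced by a vertex set. -/
def ind (G : LoopGraph V) (S : Set V) : LoopGraph S where
  Adj x y := G.Adj x y
  symm := fun _ _ h => G.symm h

/-- A surjection that makes exactly the prescribed identifications presents the quotient. -/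
noncomputable def identifyIso {W : Type*} (G : LoopGraph W) (r : W → W → Prop) (P : LoopGraph V)
    (h : W → V) (hr : ∀ s t, r s t → h s = h t)
    (hinj : ∀ s t, h s = h t → Quot.mk r s = Quot.mk r t)
    (hsurj : Function.Surjective h)
    (hadj : ∀ p q, P.Adj p q ↔ ∃ x y, h x = p ∧ h y = q ∧ G.Adj x y) :
    (G.identify r).Adj ≃r P.Adj where
  toEquiv := Equiv.ofBijective (Quot.lift h hr) ⟨by
    rintro ⟨s⟩ ⟨t⟩ hst
    exact hinj s t hst, fun p => (hsurj p).imp' (Quot.mk r) fun _ hs => hs⟩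
  map_rel_iff' := by
    rintro ⟨s⟩ ⟨t⟩
    simp only [hadj, identify]
    constructor
    · rintro ⟨x, y, hx, hy, hxy⟩
      exact ⟨x, y, hinj _ _ hx, hinj _ _ hy, hxy⟩
    · rintro ⟨x, y, hx, hy, hxy⟩
      exact ⟨x, y, congrArg (Quot.lift h hr) hx, congrArg (Quot.lift h hr) hy, hxy⟩

end LoopGraph

namespace BilabelledGraph

open LoopGraph

/-- The `(1,1)`-bilabelled graph with underlying graph `G` and labels `a` and `b`. -/
def ofLoopGraph {V : Type u} [Finite V] (G : LoopGraph V) (a b : V) : BilabelledGraph.{u} 1 :=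
  ⟨V, inferInstance, G, fun _ => a, fun _ => b⟩

theorem ofLoopGraph_eta (F : BilabelledGraph.{u} 1) :
    ofLoopGraph F.graph (F.inLabel 0) (F.outLabel 0) = F := by
  obtain ⟨V, hV, G, a, b⟩ := F
  simp only [ofLoopGraph, mk.injEq, heq_eq_eq, true_and]
  exact ⟨funext fun i => by rw [Subsingleton.elim i 0], funext fun i => by
    rw [Subsingleton.elim i 0]⟩

/-- `(G, a, b)` belongs to `𝓛₁`. -/
def InL {V : Type u} [Finite V] (G : LoopGraph V) (a b : V) : Prop :=
  MemL 1 (ofLoopGraph G a b)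

variable {V V₁ V₂ : Type u} [Finite V] [Finite V₁] [Finite V₂]

theorem InL.atomic {G : LoopGraph V} {a b : V} (h : ∀ x, x = a ∨ x = b) : InL G a b :=
  MemL.atomic _ fun x => (h x).imp (fun h => ⟨0, h.symm⟩) (fun h => ⟨0, h.symm⟩)

theorem InL.series {G₁ : LoopGraph V₁} {G₂ : LoopGraph V₂} {G : LoopGraph V} {a₁ b₁ : V₁}
    {a₂ b₂ : V₂} (h₁ : InL G₁ a₁ b₁) (h₂ : InL G₂ a₂ b₂) {i : V₁ → V} {j : V₂ → V}
    (hi : Function.Injective i) (hj : Function.Injective j)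
    (hcover : ∀ x, (∃ a, i a = x) ∨ ∃ b, j b = x) (hglue : i b₁ = j a₂)
    (hmeet : ∀ a b, i a = j b → a = b₁ ∧ b = a₂)
    (hadj : ∀ x y, G.Adj x y ↔ (∃ a a', i a = x ∧ i a' = y ∧ G₁.Adj a a') ∨
      ∃ b b', j b = x ∧ j b' = y ∧ G₂.Adj b b') : InL G (i a₁) (j b₂) := by
  refine MemL.iso _ _ ⟨identifyIso _ _ G (Sum.elim i j) ?_ ?_ ?_ ?_, fun _ => rfl, fun _ => rfl⟩
    (MemL.series _ _ h₁ h₂)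
  · rintro _ _ ⟨k⟩
    exact hglue
  · have key : ∀ a b, i a = j b → Quot.mk (SeriesRel (ofLoopGraph G₁ a₁ b₁) (ofLoopGraph G₂ a₂ b₂))
        (.inl a) = Quot.mk _ (.inr b) := fun a b hab => by
      obtain ⟨rfl, rfl⟩ := hmeet a b hab
      exact Quot.sound (SeriesRel.glue 0)
    rintro (a | b) (a' | b') h
    · rw [hi h]
    · exact key _ _ h
    · exact (key _ _ h.symm).symm
    · rw [hj h]
  · intro x
    rcases hcover x with ⟨a, ha⟩ | ⟨b, hb⟩
    · exact ⟨.inl a, ha⟩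
    · exact ⟨.inr b, hb⟩
  · intro x y
    rw [hadj]
    constructor
    · rintro (⟨a, a', ha, ha', h⟩ | ⟨a, a', ha, ha', h⟩)
      · exact ⟨.inl a, .inl a', ha, ha', .inl h⟩
      · exact ⟨.inr a, .inr a', ha, ha', .inr h⟩
    · rintro ⟨_, _, ha, ha', h | h⟩
      · exact .inl ⟨_, _, ha, ha', h⟩
      · exact .inr ⟨_, _, ha, ha', h⟩

/-- Edges and loops at the labelled vertices may be added. -/
theorem InL.add_edges {G G' : LoopGraph V} {a b : V} (h : InL G' a b)
    (hle : ∀ x y, G'.Adj x y → G.Adj x y)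
    (hadj : ∀ x y, G.Adj x y → G'.Adj x y ∨ ((x = a ∨ x = b) ∧ (y = a ∨ y = b))) : InL G a b := by
  -- The atomic factor is the subgraph of `G` induced by the labels; edges already present in `G'`
  -- merge with their copies.
  let A : BilabelledGraph.{u} 1 :=
    ofLoopGraph (G.ind {x | x = a ∨ x = b}) ⟨a, .inl rfl⟩ ⟨b, .inr rfl⟩
  have hA : A.IsAtomic := fun x => x.2.imp (fun h => ⟨0, Subtype.ext h.symm⟩)
    (fun h => ⟨0, Subtype.ext h.symm⟩)
  refine MemL.iso _ _ ⟨identifyIso _ _ G (Sum.elim Subtype.val id) ?_ ?_ ?_ ?_, fun _ => rfl,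
    fun _ => rfl⟩ (MemL.parallel A _ hA h)
  · rintro _ _ (k | k) <;> rfl
  · let r := ParallelRel A (ofLoopGraph G' a b)
    have key : ∀ s : A.V ⊕ V, Quot.mk r s = Quot.mk r (.inr (Sum.elim Subtype.val id s)) := by
      rintro (⟨x, rfl | rfl⟩ | x)
      · exact Quot.sound (ParallelRel.glueIn 0)
      · exact Quot.sound (ParallelRel.glueOut 0)
      · rfl
    intro s t hst
    exact (key s).trans (hst ▸ (key t).symm)
  · exact fun x => ⟨.inr x, rfl⟩
  · intro x y
    constructor
    · intro hxy
      rcases hadj x y hxy with h | ⟨hx, hy⟩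
      · exact ⟨.inr x, .inr y, rfl, rfl, .inr h⟩
      · exact ⟨.inl ⟨x, hx⟩, .inl ⟨y, hy⟩, rfl, rfl, .inl hxy⟩
    · rintro ⟨_, _, rfl, rfl, h | h⟩
      · exact h
      · exact hle _ _ h

/-- The out-label may be moved to the position of the in-label. -/
theorem InL.identify_labels {G : LoopGraph V} {a b : V} (h : InL G a b) : InL G a a := by
  -- Series composition with the edgeless graph `E` on two vertices moves the out-label to a new
  -- isolated vertex. Parallel composition with the single vertex `A` then merges that vertex into
  -- `a`.
  let E : LoopGraph (ULift.{u} Bool) := ⟨fun _ _ => False, fun _ _ h => h⟩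
  let G' : LoopGraph (Option V) :=
    ⟨fun x y => ∃ a b, some a = x ∧ some b = y ∧ G.Adj a b, fun _ _ ⟨a, b, ha, hb, h⟩ =>
      ⟨b, a, hb, ha, G.symm h⟩⟩
  have hE : InL E ⟨false⟩ ⟨true⟩ := InL.atomic (by rintro ⟨_ | _⟩ <;> simp)
  have h1 : InL G' (some a) none := by
    refine InL.series (i := some) (j := fun c => if c.down then none else some b) h hE
      (Option.some_injective _) ?_ ?_ rfl ?_ ?_
    · rintro ⟨_ | _⟩ ⟨_ | _⟩ <;> simp
    · rintro (_ | x)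
      · exact .inr ⟨⟨true⟩, rfl⟩
      · exact .inl ⟨x, rfl⟩
    · rintro x ⟨_ | _⟩ <;> simp
    · intro x y
      simp [G', E]
  let A : BilabelledGraph.{u} 1 := ofLoopGraph (V := PUnit) ⟨fun _ _ => False, fun _ _ h => h⟩
    ⟨⟩ ⟨⟩
  have hA : A.IsAtomic := fun x => .inl ⟨0, rfl⟩
  refine MemL.iso _ _ ⟨identifyIso _ _ G (Sum.elim (fun _ => a) (fun o => o.getD a)) ?_ ?_ ?_ ?_,
    fun _ => rfl, fun _ => rfl⟩ (MemL.parallel A _ hA h1)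
  · rintro _ _ (k | k) <;> rfl
  · let r := ParallelRel A (ofLoopGraph G' (some a) none)
    have e1 : Quot.mk r (.inl ⟨⟩) = Quot.mk r (.inr (some a)) := Quot.sound (ParallelRel.glueIn 0)
    have e2 : Quot.mk r (.inl ⟨⟩) = Quot.mk r (.inr none) := Quot.sound (ParallelRel.glueOut 0)
    have key : ∀ s, Quot.mk r s =
        Quot.mk r (.inr (some (Sum.elim (fun _ => a) (fun o : Option V => o.getD a) s))) := by
      rintro (⟨⟩ | _ | x)
      · exact e1
      · exact e2.symm.trans e1
      · rfl
    intro s t hst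
    exact (key s).trans (hst ▸ (key t).symm)
  · exact fun x => ⟨.inr (some x), rfl⟩
  · intro x y
    constructor
    · intro hxy
      exact ⟨.inr (some x), .inr (some y), rfl, rfl, .inr ⟨x, y, rfl, rfl, hxy⟩⟩
    · rintro ⟨_, _, rfl, rfl, h | ⟨x, y, rfl, rfl, hxy⟩⟩
      · exact h.elim
      · exact hxy

/-- The subgraph induced by `S`, with labels `a` and `b`, belongs to `𝓛₁`. -/
def IndL (G : LoopGraph V) (S : Set V) (a b : V) : Prop :=
  ∃ (ha : a ∈ S) (hb : b ∈ S), InL (G.ind S) ⟨a, ha⟩ ⟨b, hb⟩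

theorem IndL.inL {G : LoopGraph V} {a b : V} (h : IndL G Set.univ a b) : InL G a b := by
  obtain ⟨_, _, h⟩ := h
  exact MemL.iso _ _ ⟨⟨Equiv.Set.univ V, Iff.rfl⟩, fun _ => rfl, fun _ => rfl⟩ h

/-- Edges between the parts are allowed only at `c`, so each of them already lies inside one part.
-/
theorem IndL.series {G : LoopGraph V} {S T : Set V} {a b c : V} (h₁ : IndL G S a c)
    (h₂ : IndL G T c b) (hST : ∀ x ∈ S, x ∈ T → x = c)
    (hadj : ∀ x ∈ S, ∀ y ∈ T, G.Adj x y → x = c ∨ y = c) : IndL G (S ∪ T) a b := by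
  obtain ⟨ha, hc, h₁⟩ := h₁
  obtain ⟨hc', hb, h₂⟩ := h₂
  refine ⟨.inl ha, .inr hb, InL.series (i := Set.inclusion Set.subset_union_left)
    (j := Set.inclusion Set.subset_union_right) h₁ h₂ (Set.inclusion_injective _)
    (Set.inclusion_injective _) ?_ rfl ?_ ?_⟩
  · rintro ⟨x, hx | hx⟩
    · exact .inl ⟨⟨x, hx⟩, rfl⟩
    · exact .inr ⟨⟨x, hx⟩, rfl⟩
  · rintro ⟨x, hx⟩ ⟨y, hy⟩ hxy
    obtain rfl : x = y := congrArg Subtype.val hxy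
    obtain rfl := hST x hx hy
    exact ⟨rfl, rfl⟩
  · rintro ⟨x, hx⟩ ⟨y, hy⟩
    constructor
    · intro hxy
      suffices h : (x ∈ S ∧ y ∈ S) ∨ (x ∈ T ∧ y ∈ T) from
        h.imp (fun h => ⟨⟨x, h.1⟩, ⟨y, h.2⟩, rfl, rfl, hxy⟩)
          fun h => ⟨⟨x, h.1⟩, ⟨y, h.2⟩, rfl, rfl, hxy⟩
      rcases hx with hx | hx <;> rcases hy with hy | hy
      · exact .inl ⟨hx, hy⟩
      · rcases hadj x hx y hy hxy with rfl | rfl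
        · exact .inr ⟨hc', hy⟩
        · exact .inl ⟨hx, hc⟩
      · rcases hadj y hy x hx (G.symm hxy) with rfl | rfl
        · exact .inr ⟨hx, hc'⟩
        · exact .inl ⟨hc, hy⟩
      · exact .inr ⟨hx, hy⟩
    · rintro (⟨p, q, hp, hq, h⟩ | ⟨p, q, hp, hq, h⟩)
      · obtain rfl : p.1 = x := congrArg Subtype.val hp
        obtain rfl : q.1 = y := congrArg Subtype.val hq
        exact h
      · obtain rfl : p.1 = x := congrArg Subtype.val hp
        obtain rfl : q.1 = y := congrArg Subtype.val hq
        exact h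

theorem IndL.pair (G : LoopGraph V) (a b : V) : IndL G {a, b} a b :=
  ⟨.inl rfl, .inr rfl, InL.atomic (by
    rintro ⟨x, rfl | rfl⟩
    · exact .inl rfl
    · exact .inr rfl)⟩

end BilabelledGraph

/-! ### Menger's theorem for two connections -/

namespace LoopGraph

variable {V : Type u}

/-- A single vertex `c` separates `X` from `Y`: some set `S` that can only be left through `c`
contains `X` up to `c` and does not meet `Y`. -/
def Separable (G : LoopGraph V) (X Y : Set V) : Prop :=
  ∃ (c : V) (S : Set V), X ⊆ insert c S ∧ Disjoint S Y ∧
    ∀ x ∈ S, ∀ y, G.Adj x y → y ∈ insert c S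

/-- The graph obtained from `G` by deleting the edge between `p` and `q`. -/
def deleteEdge (G : LoopGraph V) (p q : V) : LoopGraph V where
  Adj x y := G.Adj x y ∧ ¬ (x = p ∧ y = q) ∧ ¬ (x = q ∧ y = p)
  symm := fun _ _ h => ⟨G.symm h.1, fun h' => h.2.2 ⟨h'.2, h'.1⟩, fun h' => h.2.1 ⟨h'.2, h'.1⟩⟩

/-- The graph with only those edges of `G` that lie inside `R`. -/
def restrict (G : LoopGraph V) (R : Set V) : LoopGraph V where
  Adj x y := G.Adj x y ∧ x ∈ R ∧ y ∈ R
  symm := fun _ _ h => ⟨G.symm h.1, h.2.2, h.2.1⟩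

theorem PConn.subset_of_restrict {G : LoopGraph V} {A R : Set V} (hA : (G.restrict R).PConn A)
    (hne : (A ∩ R).Nonempty) : A ⊆ R :=
  hA.subset_of_closed hne fun _ _ _ _ _ h => h.2.2

/-- Menger's theorem for two disjoint connections. -/
theorem exists_disjoint_connections [Finite V] [Nonempty V] (G : LoopGraph V) (X Y : Set V)
    (h : ¬ G.Separable X Y) : ∃ A B : Set V, Disjoint A B ∧ G.PConn A ∧ G.PConn B ∧
      (A ∩ X).Nonempty ∧ (A ∩ Y).Nonempty ∧ (B ∩ X).Nonempty ∧ (B ∩ Y).Nonempty := by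
  -- Induction on the number of edges. If deleting an edge creates a separation by `s` with side
  -- `S`, connections are found on each side and glued at `s` and along the deleted edge.
  induction hn : {p : V × V | G.Adj p.1 p.2}.ncard using Nat.strong_induction_on
    generalizing G X Y with
  | _ n ih =>
  by_cases hE : ∀ x y, ¬ G.Adj x y
  · have c₀ : V := Classical.arbitrary V
    have hex : ∀ c, ∃ a ∈ X, a ∈ Y ∧ a ≠ c := fun c => by
      by_contra! hc
      refine h ⟨c, X \ {c}, fun x hx => ?_, Set.disjoint_left.2 fun x hx hxY =>
        hx.2 (hc x hx.1 hxY), fun x _ y hxy => absurd hxy (hE x y)⟩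
      by_cases hxc : x = c
      · exact .inl hxc
      · exact .inr ⟨hx, hxc⟩
    obtain ⟨a, haX, haY, -⟩ := hex c₀
    obtain ⟨b, hbX, hbY, hba⟩ := hex a
    exact ⟨{a}, {b}, by simpa using hba.symm, PConn.singleton _ _, PConn.singleton _ _,
      ⟨a, rfl, haX⟩, ⟨a, rfl, haY⟩, ⟨b, rfl, hbX⟩, ⟨b, rfl, hbY⟩⟩
  push Not at hE
  obtain ⟨p, q, hpq⟩ := hE
  have hlt : ∀ G' : LoopGraph V, (∀ x y, G'.Adj x y → (G.deleteEdge p q).Adj x y) →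
      {p : V × V | G'.Adj p.1 p.2}.ncard < n := fun G' hG' => by
    rw [← hn]
    refine Set.ncard_lt_ncard ⟨fun z hz => (hG' _ _ hz).1, fun hsub => ?_⟩ (Set.toFinite _)
    exact (hG' p q (hsub (show (p, q) ∈ {p : V × V | G.Adj p.1 p.2} from hpq))).2.1 ⟨rfl, rfl⟩
  by_cases hsep : (G.deleteEdge p q).Separable X Y
  swap
  · obtain ⟨A, B, hAB, hA, hB, h'⟩ := ih _ (hlt _ fun _ _ h => h) _ X Y hsep rfl
    exact ⟨A, B, hAB, hA.mono fun _ _ h => h.1, hB.mono fun _ _ h => h.1, h'⟩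
  obtain ⟨s, S, hXS, hSY, hcl, hsS⟩ : ∃ s S, X ⊆ insert s S ∧ Disjoint S Y ∧
      (∀ x ∈ S, ∀ y, (G.deleteEdge p q).Adj x y → y ∈ insert s S) ∧ s ∉ S := by
    obtain ⟨s, S, h1, h2, h3⟩ := hsep
    refine ⟨s, S \ {s}, by simpa using h1, h2.mono_left Set.sdiff_subset, fun x hx y hxy => ?_,
      by simp⟩
    simpa using h3 x hx.1 y hxy
  /- The deleted edge leaves `S`. -/
  obtain ⟨x, y, hxS, hyS, hxy, hdel⟩ : ∃ x y, x ∈ S ∧ y ∉ S ∧ G.Adj x y ∧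
      ∀ a b, G.Adj a b → (G.deleteEdge p q).Adj a b ∨ (a = x ∧ b = y) ∨ (a = y ∧ b = x) := by
    by_contra! hno
    refine h ⟨s, S, hXS, hSY, fun x hx y hxy => ?_⟩
    by_contra hy
    obtain ⟨a, b, hab, hdel, h1, h2⟩ := hno x y hx (fun h => hy (.inr h)) hxy
    have hxyd : ¬ (G.deleteEdge p q).Adj x y := fun h => hy (hcl x hx y h)
    have hend : ∀ c d, G.Adj c d → ¬ (G.deleteEdge p q).Adj c d → c = p ∧ d = q ∨ c = q ∧ d = p :=
      fun c d hcd hn => by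
        by_contra! hne
        exact hn ⟨hcd, fun h => hne.1 h.1 h.2, fun h => hne.2 h.1 h.2⟩
    rcases hend x y hxy hxyd with ⟨rfl, rfl⟩ | ⟨rfl, rfl⟩ <;>
      rcases hend a b hab hdel with ⟨rfl, rfl⟩ | ⟨rfl, rfl⟩
    · exact h1 rfl rfl
    · exact h2 rfl rfl
    · exact h2 rfl rfl
    · exact h1 rfl rfl
  have hdel' : ∀ a b, G.Adj a b → (a = x → b ≠ y) → (a = y → b ≠ x) →
      (G.deleteEdge p q).Adj a b := fun a b hab h1 h2 => by
    have := hdel a b hab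
    tauto
  -- A vertex that separates `X` from `{s, x}` within `S ∪ {s}` would separate `X` from `Y` in `G`,
  -- because `S` can be left only through `s` or along `xy`.
  obtain ⟨A₁, A₂, hA₁₂, hA₁, hA₂, hA₁X, hA₂X, hsA₁, hxA₂, hA₁S, hA₂S⟩ :
      ∃ A₁ A₂ : Set V, Disjoint A₁ A₂ ∧ G.PConn A₁ ∧ G.PConn A₂ ∧ (A₁ ∩ X).Nonempty ∧
        (A₂ ∩ X).Nonempty ∧ s ∈ A₁ ∧ x ∈ A₂ ∧ A₁ ⊆ insert s S ∧ A₂ ⊆ insert s S := by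
    have hns : ¬ ((G.deleteEdge p q).restrict (insert s S)).Separable X {s, x} := by
      rintro ⟨c, T, hXT, hTY, hT⟩
      have hsT : s ∉ T := fun h => Set.disjoint_left.1 hTY h (.inl rfl)
      have hxT : x ∉ T := fun h => Set.disjoint_left.1 hTY h (.inr rfl)
      refine h ⟨c, T ∩ S, fun a ha => ?_, hSY.mono_left Set.inter_subset_right,
        fun a ha b hab => ?_⟩
      · have := hXT ha
        have := hXS ha
        simp only [Set.mem_insert_iff, Set.mem_inter_iff] at *
        grind
      · have had := hdel' a b hab (fun h => absurd ha.1 (h ▸ hxT)) (fun h => absurd ha.2 (h ▸ hyS))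
        have hbS := hcl a ha.2 b had
        have := hT a ha.1 b ⟨had, .inr ha.2, hbS⟩
        simp only [Set.mem_insert_iff, Set.mem_inter_iff] at *
        grind
    obtain ⟨A, B, hAB, hA, hB, hAX, ⟨a, haA, ha⟩, hBX, ⟨b, hbB, hb⟩⟩ :=
      ih _ (hlt ((G.deleteEdge p q).restrict (insert s S)) fun _ _ h => h.1) _ X {s, x} hns rfl
    have hsub : ∀ a, a ∈ ({s, x} : Set V) → a ∈ insert s S := by
      rintro _ (rfl | rfl)
      · exact .inl rfl
      · exact .inr hxS
    have hAS := hA.subset_of_restrict ⟨a, haA, hsub a ha⟩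
    have hBS := hB.subset_of_restrict ⟨b, hbB, hsub b hb⟩
    replace hA : G.PConn A := hA.mono fun _ _ h => h.1.1
    replace hB : G.PConn B := hB.mono fun _ _ h => h.1.1
    rcases ha with rfl | rfl <;> rcases hb with rfl | rfl
    · exact absurd hbB (Set.disjoint_left.1 hAB haA)
    · exact ⟨A, B, hAB, hA, hB, hAX, hBX, haA, hbB, hAS, hBS⟩
    · exact ⟨B, A, hAB.symm, hB, hA, hBX, hAX, hbB, haA, hBS, hAS⟩
    · exact absurd hbB (Set.disjoint_left.1 hAB haA)
  -- Likewise, a separation of `{s, y}` from `Y` outside `S` extends by `S` to one of `X` from `Y`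
  -- in `G`.
  obtain ⟨B₁, B₂, hB₁₂, hB₁, hB₂, hB₁Y, hB₂Y, hsB₁, hyB₂, hB₁S, hB₂S⟩ :
      ∃ B₁ B₂ : Set V, Disjoint B₁ B₂ ∧ G.PConn B₁ ∧ G.PConn B₂ ∧ (B₁ ∩ Y).Nonempty ∧
        (B₂ ∩ Y).Nonempty ∧ s ∈ B₁ ∧ y ∈ B₂ ∧ B₁ ⊆ Sᶜ ∧ B₂ ⊆ Sᶜ := by
    have hns : ¬ ((G.deleteEdge p q).restrict Sᶜ).Separable {s, y} Y := by
      rintro ⟨c, T, hXT, hTY, hT⟩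
      have hsT := hXT (.inl rfl)
      have hyT := hXT (.inr rfl)
      refine h ⟨c, S ∪ (T ∩ Sᶜ), fun a ha => ?_, ?_, fun a ha b hab => ?_⟩
      · have := hXS ha
        simp only [Set.mem_insert_iff, Set.mem_union, Set.mem_inter_iff, Set.mem_compl_iff] at *
        grind
      · exact Set.disjoint_union_left.2 ⟨hSY, hTY.mono_left Set.inter_subset_left⟩
      · have h1 := hdel a b hab
        have h2 : a ∈ S → (G.deleteEdge p q).Adj a b → _ := fun ha => hcl a ha b
        have h3 : a ∈ T → _ → _ → _ → _ := fun ha h1 h2 h3 => hT a ha b ⟨h1, h2, h3⟩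
        simp only [Set.mem_insert_iff, Set.mem_union, Set.mem_inter_iff, Set.mem_compl_iff] at *
        grind
    obtain ⟨A, B, hAB, hA, hB, ⟨a, haA, ha⟩, hAX, ⟨b, hbB, hb⟩, hBX⟩ :=
      ih _ (hlt ((G.deleteEdge p q).restrict Sᶜ) fun _ _ h => h.1) _ {s, y} Y hns rfl
    have hsub : ∀ a, a ∈ ({s, y} : Set V) → a ∈ Sᶜ := by
      rintro _ (rfl | rfl)
      · exact hsS
      · exact hyS
    have hAS := hA.subset_of_restrict ⟨a, haA, hsub a ha⟩
    have hBS := hB.subset_of_restrict ⟨b, hbB, hsub b hb⟩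
    replace hA : G.PConn A := hA.mono fun _ _ h => h.1.1
    replace hB : G.PConn B := hB.mono fun _ _ h => h.1.1
    rcases ha with rfl | rfl <;> rcases hb with rfl | rfl
    · exact absurd hbB (Set.disjoint_left.1 hAB haA)
    · exact ⟨A, B, hAB, hA, hB, hAX, hBX, haA, hbB, hAS, hBS⟩
    · exact ⟨B, A, hAB.symm, hB, hA, hBX, hAX, hbB, haA, hBS, hAS⟩
    · exact absurd hbB (Set.disjoint_left.1 hAB haA)
  refine ⟨A₁ ∪ B₁, A₂ ∪ B₂, ?_, hA₁.union hB₁ ⟨s, hsA₁, s, hsB₁, .inl rfl⟩,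
    hA₂.union hB₂ ⟨x, hxA₂, y, hyB₂, .inr hxy⟩, hA₁X.mono (by gcongr; simp),
    hB₁Y.mono (by gcongr; simp), hA₂X.mono (by gcongr; simp), hB₂Y.mono (by gcongr; simp)⟩
  rw [Set.disjoint_left] at *
  rintro a (ha | ha) (hb | hb)
  · exact hA₁₂ ha hb
  · rcases hA₁S ha with rfl | haS
    · exact hB₁₂ hsB₁ hb
    · exact hB₂S hb haS
  · rcases hA₂S hb with rfl | haS
    · exact hA₁₂ hsA₁ hb
    · exact hB₁S ha haS
  · exact hB₁₂ ha hb

/-- Two non-adjacent vertices are connected by two disjoint sets unless they are separated by at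
most one vertex. -/
theorem exists_connectors_or_separator [Finite V] (G : LoopGraph V) {u v : V} (huv : u ≠ v)
    (hadj : ¬ G.Adj u v) :
    (∃ A B : Set V, Disjoint A B ∧ G.PConn A ∧ G.PConn B ∧ (u ∉ A ∧ v ∉ A) ∧ (u ∉ B ∧ v ∉ B) ∧
      (∃ a ∈ A, G.Adj u a) ∧ (∃ a ∈ A, G.Adj v a) ∧ (∃ b ∈ B, G.Adj u b) ∧ ∃ b ∈ B, G.Adj v b) ∨
    (∃ S : Set V, u ∈ S ∧ v ∉ S ∧ ∀ x ∈ S, ∀ y, G.Adj x y → y ∈ S) ∨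
    ∃ (c : V) (S : Set V), c ≠ u ∧ c ≠ v ∧ u ∈ S ∧ v ∉ S ∧ c ∉ S ∧
      ∀ x ∈ S, ∀ y, G.Adj x y → y ∈ insert c S := by
  have : Nonempty V := ⟨u⟩
  let R : Set V := {x | x ≠ u ∧ x ≠ v}
  -- Menger's theorem is applied between the neighbourhoods of `u` and `v` in the graph without `u`
  -- and `v`.
  by_cases hsep : (G.restrict R).Separable ({x | G.Adj u x} ∩ R) ({x | G.Adj v x} ∩ R)
  · right
    obtain ⟨c, S, hX, hY, hcl⟩ := hsep
    let S' : Set V := insert u ((S ∩ R) \ {c})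
    have hv : v ∉ S' := by
      rintro (h | h)
      · exact huv h.symm
      · exact h.1.2.2 rfl
    have hS' : ∀ x ∈ S', ∀ y, G.Adj x y → y ∈ S' ∨ (y = c ∧ c ∈ R) := by
      intro x hx y hxy
      by_cases hyu : y = u
      · exact .inl (.inl hyu)
      rcases hx with rfl | ⟨⟨hxS, hxR⟩, hxc⟩
      · have hyv : y ≠ v := fun h => hadj (h ▸ hxy)
        have := hX ⟨hxy, hyu, hyv⟩
        simp only [S', R, Set.mem_insert_iff, Set.mem_inter_iff, Set.mem_sdiff, Set.mem_ofPred_eq,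
          Set.mem_singleton_iff] at *
        grind
      · have hyv : y ≠ v := fun h => Set.disjoint_left.1 hY hxS ⟨G.symm (h ▸ hxy), hxR⟩
        have := hcl x hxS y ⟨hxy, hxR, hyu, hyv⟩
        simp only [S', R, Set.mem_insert_iff, Set.mem_inter_iff, Set.mem_sdiff, Set.mem_ofPred_eq,
          Set.mem_singleton_iff] at *
        grind
    -- If `c` is `u` or `v`, it is not needed: `S'` cannot be left at all.
    by_cases hc : c ∈ R
    · refine .inr ⟨c, S', hc.1, hc.2, .inl rfl, hv, ?_, fun x hx y hxy => ?_⟩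
      · rintro (h | h)
        · exact hc.1 h
        · exact h.2 rfl
      · exact (hS' x hx y hxy).elim .inr fun h => .inl h.1
    · exact .inl ⟨S', .inl rfl, hv, fun x hx y hxy => (hS' x hx y hxy).resolve_right
        fun h => hc h.2⟩
  · left
    obtain ⟨A, B, hAB, hA, hB, ⟨a, haA, ha⟩, ⟨a', haA', ha'⟩, ⟨b, hbB, hb⟩, ⟨b', hbB', hb'⟩⟩ :=
      exists_disjoint_connections _ _ _ hsep
    have hAR := hA.subset_of_restrict ⟨a, haA, ha.2⟩
    have hBR := hB.subset_of_restrict ⟨b, hbB, hb.2⟩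
    exact ⟨A, B, hAB, hA.mono fun _ _ h => h.1, hB.mono fun _ _ h => h.1,
      ⟨fun h => (hAR h).1 rfl, fun h => (hAR h).2 rfl⟩,
      ⟨fun h => (hBR h).1 rfl, fun h => (hBR h).2 rfl⟩,
      ⟨a, haA, ha.1⟩, ⟨a', haA', ha'.1⟩, ⟨b, hbB, hb.1⟩, ⟨b', hbB', hb'.1⟩⟩

end LoopGraph

/-! ### Connectors and forbidden minors -/

namespace LoopGraph

variable {V : Type u} {V' : Type v}

theorem PConn.image {G : LoopGraph V} {G' : LoopGraph V'} {A : Set V} (hA : G.PConn A) {f : V → V'}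
    (hf : ∀ x y, G.Adj x y → G'.Adj (f x) (f y)) : G'.PConn (f '' A) := by
  rintro S hS ⟨_, hx⟩ hcl _ ⟨y, hy, rfl⟩
  obtain ⟨x, hxA, rfl⟩ := hS hx
  exact hA.subset_of_closed (S := f ⁻¹' S) ⟨x, hxA, hx⟩
    (fun a _ haS b hb hab => hcl _ haS _ ⟨b, hb, rfl⟩ (hf a b hab)) hy

theorem IsOuterplanar.ind {G : LoopGraph V} (h : G.IsOuterplanar) (S : Set V) :
    (G.ind S).IsOuterplanar :=
  h.of_injective Subtype.val_injective fun _ _ h => h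

/-- A path between two vertices of `R` is obtained by contracting a connected set `T` outside
of `R`. -/
theorem IsOuterplanar.ind_addPath {G H : LoopGraph V} (hH : H.IsOuterplanar)
    (hGH : ∀ x y, G.Adj x y → H.Adj x y) {R T : Set V} (hT : H.PConn T) (hRT : Disjoint R T)
    {p q : V} (hp : p ∈ R) (hq : q ∈ R) (hpT : ∃ t ∈ T, H.Adj p t) (hqT : ∃ t ∈ T, H.Adj q t) :
    ((G.ind R).addPath ⟨p, hp⟩ ⟨q, hq⟩).IsOuterplanar := by
  have hpq : ∀ x : R, x = ⟨p, hp⟩ ∨ x = ⟨q, hq⟩ → ∃ t ∈ T, H.Adj x t := by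
    rintro x (rfl | rfl)
    · exact hpT
    · exact hqT
  refine hH.of_minor (φ := fun o => o.elim T fun x => {x.1}) ?_ ?_ ?_
  · rintro (_ | x)
    · exact ⟨hpT.imp fun _ h => h.1, hT⟩
    · exact ⟨⟨_, rfl⟩, PConn.singleton _ _⟩
  · rintro (_ | x) (_ | y) hxy
    · exact absurd rfl hxy
    · exact Set.disjoint_singleton_right.2 (Set.disjoint_left.1 hRT y.2)
    · exact Set.disjoint_singleton_left.2 (Set.disjoint_left.1 hRT x.2)
    · refine Set.disjoint_singleton.2 fun h => hxy ?_
      rw [Subtype.ext h]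
  · rintro (_ | x) (_ | y) _ hxy
    · exact hxy.elim
    · obtain ⟨t, ht, hyt⟩ := hpq y hxy
      exact ⟨t, ht, y, rfl, H.symm hyt⟩
    · obtain ⟨t, ht, hxt⟩ := hpq x hxy
      exact ⟨x, rfl, t, ht, hxt⟩
    · exact ⟨x, rfl, y, rfl, hGH _ _ hxy⟩

/-- The graph obtained from `G` by adding an edge between `a` and `b`. -/
def addEdge (G : LoopGraph V) (a b : V) : LoopGraph V where
  Adj x y := G.Adj x y ∨ (x = a ∧ y = b) ∨ (x = b ∧ y = a)
  symm := fun _ _ h => h.imp (fun h => G.symm h) fun h => h.symm.imp And.symm And.symm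

/-- The new vertex of the path is contracted into `a`. -/
theorem IsOuterplanar.addEdge {G : LoopGraph V} {a b : V} (h : (G.addPath a b).IsOuterplanar) :
    (G.addEdge a b).IsOuterplanar := by
  classical
  refine h.of_minor (φ := fun x => if x = a then {none, some x} else {some x}) ?_ ?_ ?_
  · intro x
    split_ifs with hx
    · exact ⟨⟨none, .inl rfl⟩, (PConn.singleton _ _).insert (.inr ⟨_, rfl, .inl hx⟩)⟩
    · exact ⟨⟨_, rfl⟩, PConn.singleton _ _⟩
  · intro x y hxy
    split_ifs with hx hy hy
    · exact absurd (hx.trans hy.symm) hxy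
    all_goals simp [hxy, hxy.symm]
  · have hmem : ∀ x, some x ∈ (if x = a then {none, some x} else {some x} : Set (Option V)) :=
      fun x => by split_ifs <;> simp
    rintro x y _ (hxy | ⟨rfl, rfl⟩ | ⟨rfl, rfl⟩)
    · exact ⟨some x, hmem x, some y, hmem y, hxy⟩
    · exact ⟨none, by simp, some y, hmem y, .inr rfl⟩
    · exact ⟨some x, hmem x, none, by simp, .inr rfl⟩

/-- Two disjoint connected sets `A` and `B`, both joined to `a` and to `b`. -/
def HasConnectors (G : LoopGraph V) (a b : V) : Prop :=
  ∃ A B : Set V, Disjoint A B ∧ G.PConn A ∧ G.PConn B ∧ (a ∉ A ∧ b ∉ A) ∧ (a ∉ B ∧ b ∉ B) ∧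
    (∃ x ∈ A, G.Adj a x) ∧ (∃ x ∈ A, G.Adj b x) ∧ (∃ x ∈ B, G.Adj a x) ∧ ∃ x ∈ B, G.Adj b x

/-- The connectors and the new vertex are three branch sets joined to both poles `a` and `b`, a
`K_{2,3}`. -/
theorem IsOuterplanar.not_hasConnectors {G : LoopGraph V} {a b : V} (hab : a ≠ b)
    (h : (G.addPath a b).IsOuterplanar) : ¬ G.HasConnectors a b := by
  rintro ⟨A, B, hAB, hA, hB, ⟨haA, hbA⟩, ⟨haB, hbB⟩, ⟨x₁, hx₁, h₁⟩, ⟨x₂, hx₂, h₂⟩, ⟨x₃, hx₃, h₃⟩,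
    ⟨x₄, hx₄, h₄⟩⟩
  refine h.2 ((hasMinor_iff _ _).2 ⟨Sum.elim ![{some a}, {some b}]
    ![{none}, some '' A, some '' B], ?_, ?_, ?_⟩)
  · have hA' : (G.addPath a b).PConn (some '' A) := hA.image fun _ _ h => h
    have hB' : (G.addPath a b).PConn (some '' B) := hB.image fun _ _ h => h
    rintro (i | i) <;> fin_cases i
    · exact ⟨⟨_, rfl⟩, PConn.singleton _ _⟩
    · exact ⟨⟨_, rfl⟩, PConn.singleton _ _⟩
    · exact ⟨⟨_, rfl⟩, PConn.singleton _ _⟩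
    · exact ⟨⟨_, x₁, hx₁, rfl⟩, hA'⟩
    · exact ⟨⟨_, x₃, hx₃, rfl⟩, hB'⟩
  · have hAB' : Disjoint (some '' A) (some '' B) :=
      (Set.disjoint_image_iff (Option.some_injective _)).2 hAB
    rintro (i | i) (j | j) hij <;> fin_cases i <;> fin_cases j
    all_goals first
      | exact absurd rfl hij
      | exact hAB'
      | exact hAB'.symm
      | simp [hab, hab.symm, haA, hbA, haB, hbB]
  · have key : ∀ (i : Fin 2) (j : Fin 3), ∃ x ∈ (![{some a}, {some b}] : Fin 2 → Set (Option V)) i,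
        ∃ y ∈ (![{none}, some '' A, some '' B] : Fin 3 → Set (Option V)) j,
          (G.addPath a b).Adj x y := by
      intro i j
      fin_cases i <;> fin_cases j
      · exact ⟨_, rfl, _, rfl, .inl rfl⟩
      · exact ⟨_, rfl, _, ⟨x₁, hx₁, rfl⟩, h₁⟩
      · exact ⟨_, rfl, _, ⟨x₃, hx₃, rfl⟩, h₃⟩
      · exact ⟨_, rfl, _, rfl, .inr rfl⟩
      · exact ⟨_, rfl, _, ⟨x₂, hx₂, rfl⟩, h₂⟩
      · exact ⟨_, rfl, _, ⟨x₄, hx₄, rfl⟩, h₄⟩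
    rintro (i | i) (j | j) hij
    · simp at hij
    · exact key i j
    · obtain ⟨x, hx, y, hy, hxy⟩ := key j i
      exact ⟨y, hy, x, hx, LoopGraph.symm _ hxy⟩
    · simp at hij

theorem not_isOuterplanar_of_adjacent_connectors {G : LoopGraph V} {a b : V} (hab : a ≠ b)
    (hadj : G.Adj a b) {A B : Set V} (hAB : Disjoint A B) (hA : G.PConn A) (hB : G.PConn B)
    (haA : a ∉ A) (hbA : b ∉ A) (haB : a ∉ B) (hbB : b ∉ B) (h₁ : ∃ x ∈ A, G.Adj a x)
    (h₂ : ∃ x ∈ A, G.Adj b x) (h₃ : ∃ x ∈ B, G.Adj a x) (h₄ : ∃ x ∈ B, G.Adj b x)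
    (h₅ : ∃ x ∈ A, ∃ y ∈ B, G.Adj x y) : ¬ G.IsOuterplanar := by
  obtain ⟨x₁, hx₁, h₁⟩ := h₁
  obtain ⟨x₂, hx₂, h₂⟩ := h₂
  obtain ⟨x₃, hx₃, h₃⟩ := h₃
  obtain ⟨x₄, hx₄, h₄⟩ := h₄
  refine fun h => h.1 ((hasMinor_iff _ _).2 ⟨![{a}, {b}, A, B], ?_, ?_, ?_⟩)
  · intro i
    fin_cases i
    · exact ⟨⟨_, rfl⟩, PConn.singleton _ _⟩
    · exact ⟨⟨_, rfl⟩, PConn.singleton _ _⟩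
    · exact ⟨⟨_, hx₁⟩, hA⟩
    · exact ⟨⟨_, hx₃⟩, hB⟩
  · intro i j hij
    fin_cases i <;> fin_cases j
    all_goals first
      | exact absurd rfl hij
      | exact hAB
      | exact hAB.symm
      | simp [hab, hab.symm, haA, hbA, haB, hbB]
  · have key : ∀ i j : Fin 4, i < j → ∃ x ∈ (![{a}, {b}, A, B] : Fin 4 → Set V) i,
        ∃ y ∈ (![{a}, {b}, A, B] : Fin 4 → Set V) j, G.Adj x y := by
      intro i j hij
      fin_cases i <;> fin_cases j
      all_goals first
        | exact absurd hij (by decide)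
        | exact ⟨a, rfl, b, rfl, hadj⟩
        | exact ⟨a, rfl, x₁, hx₁, h₁⟩
        | exact ⟨b, rfl, x₂, hx₂, h₂⟩
        | exact ⟨a, rfl, x₃, hx₃, h₃⟩
        | exact ⟨b, rfl, x₄, hx₄, h₄⟩
        | exact h₅
    intro i j hij
    rcases lt_or_gt_of_ne hij.ne with h | h
    · exact key i j h
    · obtain ⟨x, hx, y, hy, hxy⟩ := key j i h
      exact ⟨y, hy, x, hx, G.symm hxy⟩

/-- If an outerplanar graph stays connected after deletion of `a`, then `a` is isolated or has a
neighbour `b` such that `a` and `b` do not have two disjoint connectors. -/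
theorem exists_neighbor_not_hasConnectors [Finite V] {G : LoopGraph V} (hG : G.IsOuterplanar)
    {a : V} (hconn : G.PConn {a}ᶜ) (hne : ∃ x, x ≠ a ∧ G.Adj a x) :
    ∃ b, b ≠ a ∧ G.Adj a b ∧ ¬ G.HasConnectors a b := by
  classical
  -- The neighbour `b` is chosen with a largest connected set `D` that avoids `a` and `b` and,
  -- unless empty, contains a neighbour of `a`.
  let P : Set (V × Set V) := {p | p.1 ≠ a ∧ G.Adj a p.1 ∧ G.PConn p.2 ∧ a ∉ p.2 ∧ p.1 ∉ p.2 ∧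
    (p.2 = ∅ ∨ ∃ x ∈ p.2, G.Adj a x)}
  obtain ⟨x₀, hx₀, hax₀⟩ := hne
  have hP : P.Nonempty := ⟨(x₀, ∅), hx₀, hax₀, fun S hS hS' => absurd (hS'.mono hS) (by simp),
    by simp, by simp, .inl rfl⟩
  obtain ⟨⟨b, D⟩, ⟨hba, hab, hD, haD, hbD, hDne⟩, hmax⟩ :=
    Set.exists_max_image P (fun p => p.2.ncard) (Set.toFinite _) hP
  simp only at hba hab hD haD hbD hDne hmax
  /- All other neighbours of `a` are in `D`. -/
  have hND : ∀ x, G.Adj a x → x ≠ a → x ≠ b → x ∈ D := by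
    intro x hax hxa hxb
    by_contra hxD
    have hmaxb : ∀ y, y ∉ D → y ≠ a → y ≠ b → ∀ d ∈ D, ¬ G.Adj d y := by
      intro y hyD hya hyb d hd hdy
      have := hmax (b, insert y D) ⟨hba, hab, hD.insert (.inr ⟨d, hd, hdy⟩), by
        simp [haD, hya.symm], by simp [hbD, hyb.symm],
        .inr ((hDne.resolve_left (Set.nonempty_iff_ne_empty.1 ⟨d, hd⟩)).imp
          fun x h => ⟨.inr h.1, h.2⟩)⟩
      simp only [Set.ncard_insert_of_notMem hyD] at this
      omega
    have hDb : D = ∅ ∨ ∃ d ∈ D, G.Adj d b := by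
      refine or_iff_not_imp_left.2 fun hDn => ?_
      obtain ⟨d, hd⟩ := Set.nonempty_iff_ne_empty.2 hDn
      obtain ⟨d', -, hd', y, hy, hyD, hdy⟩ := hconn.exists_adj (S := D) (x := d) (y := b)
        (fun h => haD (h ▸ hd)) hd hba hbD
      by_cases hyb : y = b
      · exact ⟨d', hd', hyb ▸ hdy⟩
      · exact absurd hdy (hmaxb y hyD hy hyb d' hd')
    -- Since `G - a` is connected, a non-empty `D` is joined to `b`. So `x` could replace `b`, with
    -- the larger set `D ∪ {b}`.
    have := hmax (x, insert b D) ⟨hxa, hax, hD.insert hDb, by simp [haD, hba.symm],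
      by simp [hxb, hxD], .inr ⟨b, .inl rfl, hab⟩⟩
    simp only [Set.ncard_insert_of_notMem hbD] at this
    omega
  refine ⟨b, hba, hab, ?_⟩
  rintro ⟨A, B, hAB, hA, hB, ⟨haA, hbA⟩, ⟨haB, hbB⟩, ⟨x₁, hx₁, h₁⟩, h₂, ⟨x₃, hx₃, h₃⟩, h₄⟩
  /- Enlarge `A` until it is adjacent to `B`. -/
  let Q : Set (Set V) := {C | A ⊆ C ∧ Disjoint C B ∧ G.PConn C ∧ a ∉ C ∧ b ∉ C}
  obtain ⟨C, ⟨hAC, hCB, hC, haC, hbC⟩, hCmax⟩ :=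
    Set.exists_max_image Q Set.ncard (Set.toFinite _) ⟨A, subset_rfl, hAB, hA, haA, hbA⟩
  have hDx₁ := hND x₁ h₁ (fun h => haA (h ▸ hx₁)) fun h => hbA (h ▸ hx₁)
  have hDx₃ := hND x₃ h₃ (fun h => haB (h ▸ hx₃)) fun h => hbB (h ▸ hx₃)
  -- `D` meets both `C` and `B`, so an edge inside `D` leaves `C`. By maximality of `C` it ends in
  -- `B`, which completes a `K₄` on `a`, `b`, `C`, `B`.
  obtain ⟨d, -, hdC, y, hyD, hyC, hdy⟩ := hD.exists_adj (S := C) hDx₁ (hAC hx₁) hDx₃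
    (Set.disjoint_right.1 hCB hx₃)
  have hyB : y ∈ B := by
    by_contra hyB
    have := hCmax (insert y C) ⟨hAC.trans (Set.subset_insert _ _), by
      simp [Set.disjoint_insert_left, hyB, hCB], hC.insert (.inr ⟨d, hdC, hdy⟩),
      fun h => h.elim (fun h => haD (h ▸ hyD)) haC, fun h => h.elim (fun h => hbD (h ▸ hyD)) hbC⟩
    rw [Set.ncard_insert_of_notMem hyC] at this
    omega
  exact not_isOuterplanar_of_adjacent_connectors hba.symm hab hCB hC hB haC hbC haB hbB
    ⟨x₁, hAC hx₁, h₁⟩ (h₂.imp fun _ h => ⟨hAC h.1, h.2⟩) ⟨x₃, hx₃, h₃⟩ h₄ ⟨d, hdC, y, hyB, hdy⟩ hG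

end LoopGraph

/-! ### Decomposition by induction: `𝓞𝓟` is contained in `𝓛₁` -/

namespace BilabelledGraph

open LoopGraph

/-- For distinct labels, the expansion is outerplanar; for equal labels, the graph is. -/
def Admissible {V : Type u} (G : LoopGraph V) (a b : V) : Prop :=
  (a = b → G.IsOuterplanar) ∧ (a ≠ b → (G.addPath a b).IsOuterplanar)

/-- All admissible graphs on fewer vertices than `V` are in `𝓛₁`. -/
def SmallerInL (V : Type u) : Prop :=
  ∀ (W : Type u) [Finite W], Nat.card W < Nat.card V → ∀ (H : LoopGraph W) (a b : W),
    Admissible H a b → InL H a b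

variable {V : Type u} [Finite V]

theorem SmallerInL.indL (ih : SmallerInL V) {G : LoopGraph V} {S : Set V} {a b x : V}
    (hx : x ∉ S) (ha : a ∈ S) (hb : b ∈ S) (hab : a ≠ b)
    (h : ((G.ind S).addPath ⟨a, ha⟩ ⟨b, hb⟩).IsOuterplanar) : IndL G S a b :=
  ⟨ha, hb, ih S (Finite.card_subtype_lt hx) _ _ _
    ⟨fun h => absurd (congrArg Subtype.val h) hab, fun _ => h⟩⟩

theorem SmallerInL.indL_self (ih : SmallerInL V) {G : LoopGraph V} (hG : G.IsOuterplanar)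
    {S : Set V} {a x : V} (hx : x ∉ S) (ha : a ∈ S) : IndL G S a a :=
  ⟨ha, ha, ih S (Finite.card_subtype_lt hx) _ _ _
    ⟨fun _ => hG.ind S, fun h => absurd rfl h⟩⟩

/-- `G` is a series composition of `S` with both labels at `a`, the pair `{a, b}`, and the
complement of `S` with both labels at `b`. The outer factors carry equal labels, so outerplanarity
of `G` is enough. -/
theorem inL_of_disconnected (ih : SmallerInL V) {G : LoopGraph V} (hG : G.IsOuterplanar)
    {a b : V} {S : Set V} (ha : a ∈ S) (hb : b ∉ S)
    (hcl : ∀ x ∈ S, ∀ y, G.Adj x y → y ∈ S) : InL G a b := by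
  have hcl' : ∀ x ∈ S, ∀ y ∉ S, ¬ G.Adj x y := fun x hx y hy h => hy (hcl x hx y h)
  have h1 : IndL G (S ∪ {a, b}) a b := by
    refine (ih.indL_self hG hb ha).series (IndL.pair G a b) ?_ ?_
    · rintro x hx (rfl | rfl)
      · rfl
      · exact absurd hx hb
    · rintro x hx y (rfl | rfl) hxy
      · exact .inr rfl
      · exact absurd hxy (hcl' x hx _ hb)
  have h2 : IndL G ((S ∪ {a, b}) ∪ Sᶜ) a b := by
    refine h1.series (ih.indL_self hG (fun h => h ha) hb) ?_ ?_
    · rintro x (hx | rfl | rfl) hx'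
      · exact absurd hx hx'
      · exact absurd ha hx'
      · rfl
    · rintro x (hx | rfl | rfl) y hy hxy
      · exact absurd hxy (hcl' x hx y hy)
      · exact absurd hxy (hcl' _ ha y hy)
      · exact .inl rfl
  have huniv : (S ∪ {a, b}) ∪ Sᶜ = Set.univ := by
    ext x
    simp only [Set.mem_union, Set.mem_compl_iff, Set.mem_univ, iff_true]
    tauto
  exact (huniv ▸ h2).inL

/-- `C` is the component of `a` within `S`, and `D` that of `b` off `C` and `c`. The factors are `C
∪ {c}` with labels `a`, `c` and the complement of `C` with labels `c`, `b`. Contracting `D`,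
respectively `C`, in `H` yields their expansions, the edge `ab` of `H` supplying one half of the new
path. -/
theorem inL_of_separator (ih : SmallerInL V) {G H : LoopGraph V} (hH : H.IsOuterplanar)
    (hGH : ∀ x y, G.Adj x y → H.Adj x y) {a b c : V} (hab : H.Adj a b) {S : Set V} (hca : c ≠ a)
    (hcb : c ≠ b) (ha : a ∈ S) (hb : b ∉ S) (hc : c ∉ S)
    (hcl : ∀ x ∈ S, ∀ y, G.Adj x y → y ∈ insert c S) : InL G a b := by
  have hG : G.IsOuterplanar := hH.of_injective Function.injective_id hGH
  obtain ⟨C, hCS, haC, hC, hCcl⟩ := G.exists_component ha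
  replace hCcl : ∀ x ∈ C, ∀ y, G.Adj x y → y = c ∨ y ∈ C := fun x hx y hxy =>
    (hcl x (hCS hx) y hxy).imp_right fun hy => hCcl x hx y hy hxy
  replace hb : b ∉ C := fun h => hb (hCS h)
  replace hc : c ∉ C := fun h => hc (hCS h)
  by_cases hcC : ∃ x ∈ C, G.Adj c x
  swap
  · exact inL_of_disconnected ih hG haC hb fun x hx y hxy =>
      (hCcl x hx y hxy).resolve_left fun h => hcC ⟨x, hx, h ▸ G.symm hxy⟩
  obtain ⟨D, hDR, hbD, hD, hDcl⟩ := G.exists_component (R := {x | x ≠ c ∧ x ∉ C}) ⟨hcb.symm, hb⟩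
  by_cases hcD : ∃ x ∈ D, G.Adj c x
  swap
  -- Without a neighbour of `c`, `D` is a whole component of `G`.
  · refine inL_of_disconnected ih hG (S := Dᶜ) (fun h => (hDR h).2 haC) (fun h => h hbD)
      fun x hx y hxy hy => hx (hDcl y hy x ⟨?_, fun hxC => ?_⟩ (G.symm hxy))
    · rintro rfl
      exact hcD ⟨y, hy, hxy⟩
    · exact (hCcl x hxC y hxy).elim (hDR hy).1 (hDR hy).2
  have h1 : IndL G (insert c C) a c := by
    refine ih.indL (x := b) (by simp [hcb.symm, hb]) (.inr haC) (.inl rfl) hca.symm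
      (hH.ind_addPath hGH (hD.mono hGH) ?_ _ _ ⟨b, hbD, hab⟩
        (hcD.imp fun _ h => ⟨h.1, hGH _ _ h.2⟩))
    refine Set.disjoint_right.2 fun x hx => ?_
    have := hDR hx
    simp only [Set.mem_insert_iff, not_or]
    exact this
  have h2 : IndL G Cᶜ c b :=
    ih.indL (x := a) (fun h => h haC) hc hb hcb
      (hH.ind_addPath hGH (hC.mono hGH) disjoint_compl_left _ _
        (hcC.imp fun _ h => ⟨h.1, hGH _ _ h.2⟩) ⟨a, haC, H.symm hab⟩)
  have h3 := h1.series h2 (fun x hx hx' => hx.resolve_right hx') fun x hx y hy hxy =>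
    hx.imp_right fun hx => (hCcl x hx y hxy).resolve_right hy
  have huniv : insert c C ∪ Cᶜ = Set.univ := by
    ext x
    simp only [Set.mem_union, Set.mem_insert_iff, Set.mem_compl_iff, Set.mem_univ, iff_true]
    tauto
  exact (huniv ▸ h3).inL

/-- The edge `ab` is deleted for Menger's theorem and restored by a parallel composition. The graph
`H` is `G + ab` when the labels are distinct, and `G` itself when the lemma serves the case of equal
labels. -/
theorem inL_of_not_hasConnectors (ih : SmallerInL V) {G H : LoopGraph V} (hH : H.IsOuterplanar)
    (hGH : ∀ x y, G.Adj x y → H.Adj x y) {a b : V} (hne : a ≠ b) (hab : H.Adj a b)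
    (h : ¬ G.HasConnectors a b) : InL G a b := by
  have hle : ∀ x y, (G.deleteEdge a b).Adj x y → G.Adj x y := fun _ _ h => h.1
  have hle' : ∀ x y, (G.deleteEdge a b).Adj x y → H.Adj x y := fun _ _ h => hGH _ _ h.1
  refine InL.add_edges (G' := G.deleteEdge a b) ?_ hle fun x y hxy => ?_
  · rcases exists_connectors_or_separator (G.deleteEdge a b) hne fun h => h.2.1 ⟨rfl, rfl⟩ with
      ⟨A, B, hAB, hA, hB, h1, h2, h3, h4, h5, h6⟩ | ⟨S, ha, hb, hcl⟩ |
      ⟨c, S, hca, hcb, ha, hb, hc, hcl⟩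
    · exact absurd ⟨A, B, hAB, hA.mono hle, hB.mono hle, h1, h2,
        h3.imp fun _ h => ⟨h.1, h.2.1⟩, h4.imp fun _ h => ⟨h.1, h.2.1⟩,
        h5.imp fun _ h => ⟨h.1, h.2.1⟩, h6.imp fun _ h => ⟨h.1, h.2.1⟩⟩ h
    · exact inL_of_disconnected ih (hH.of_injective Function.injective_id hle') ha hb hcl
    · exact inL_of_separator ih hH hle' hab hca hcb ha hb hc hcl
  · by_contra! hn
    refine hn.1 ⟨hxy, ?_, ?_⟩ <;> rintro ⟨rfl, rfl⟩ <;> simp at hn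

/-- When `G - a` is connected, the graph does not get smaller: a second label is introduced, the
lemmas for distinct labels decompose `G`, and `InL.identify_labels` removes the second label again.
-/
theorem inL_self (ih : SmallerInL V) {G : LoopGraph V} (hG : G.IsOuterplanar) (a : V) :
    InL G a a := by
  by_cases hone : ∀ x, x = a
  · exact InL.atomic fun x => .inl (hone x)
  push Not at hone
  obtain ⟨b, hba⟩ := hone
  by_cases hconn : G.PConn {a}ᶜ
  · by_cases hnbr : ∃ x, x ≠ a ∧ G.Adj a x
    · obtain ⟨c, hca, hac, hno⟩ := exists_neighbor_not_hasConnectors hG hconn hnbr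
      exact (inL_of_not_hasConnectors ih hG (fun _ _ h => h) hca.symm hac hno).identify_labels
    · refine (inL_of_disconnected ih hG (S := {a}) (b := b) rfl hba ?_).identify_labels
      rintro x rfl y hxy
      by_contra hy
      exact hnbr ⟨y, hy, hxy⟩
  · simp only [PConn, not_forall] at hconn
    obtain ⟨S, hS, ⟨s, hs⟩, hcl, hn⟩ := hconn
    obtain ⟨t, hta, htS⟩ := Set.not_subset.1 hn
    have haS : a ∉ S := fun h => hS h rfl
    -- `S` is a union of components of `G - a`, so `G` is glued at `a` from `S ∪ {a}` and the
    -- complement of `S`.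
    have h := (ih.indL_self hG (S := insert a S) (x := t)
      (by simpa using ⟨hta, htS⟩) (.inl rfl)).series (ih.indL_self hG (S := Sᶜ) (x := s)
      (fun h => h hs) haS) (fun x hx hx' => hx.resolve_right hx') fun x hx y hy hxy =>
        hx.imp_right fun hx => by_contra fun hya => hy (hcl x hx y hya hxy)
    have huniv : insert a S ∪ Sᶜ = Set.univ := by
      ext x
      simp only [Set.mem_union, Set.mem_insert_iff, Set.mem_compl_iff, Set.mem_univ, iff_true]
      tauto
    exact (huniv ▸ h).inL

theorem Admissible.inL {G : LoopGraph V} {a b : V} (h : Admissible G a b) : InL G a b := by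
  induction hn : Nat.card V using Nat.strong_induction_on generalizing V with
  | _ n ih =>
  have ih' : SmallerInL V := fun W _ hW H a b h => ih _ (hn ▸ hW) h rfl
  by_cases hab : a = b
  · subst hab
    exact inL_self ih' (h.1 rfl) a
  · exact inL_of_not_hasConnectors ih' (h.2 hab).addEdge (fun _ _ h => .inl h) hab
      (.inr (.inl ⟨rfl, rfl⟩)) (IsOuterplanar.not_hasConnectors hab (h.2 hab))

theorem MemOP.isOuterplanar {F : BilabelledGraph.{u} 1} (h : F.MemOP) : F.graph.IsOuterplanar :=
  IsOuterplanar.of_injective h (Option.some_injective _) fun _ _ h => h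

theorem MemOP.memL {F : BilabelledGraph.{u} 1} (h : F.MemOP) : MemL 1 F := by
  rw [← ofLoopGraph_eta F]
  exact Admissible.inL ⟨fun _ => h.isOuterplanar, fun _ => h⟩

end BilabelledGraph

theorem mainTheorem8 :
    (∀ F : BilabelledGraph.{u} 1, BilabelledGraph.MemL 1 F ↔ F.MemOP) ∧
    (∀ (V : Type u) [Finite V] [Nonempty V] (G : LoopGraph V),
      (∃ F : BilabelledGraph.{u} 1,
        BilabelledGraph.MemL 1 F ∧ Nonempty (F.graph.Adj ≃r G.Adj)) ↔ G.IsOuterplanar) := by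
  refine ⟨fun F => ⟨fun h => h.memOP, fun h => h.memL⟩, fun V _ _ G => ⟨?_, fun h => ?_⟩⟩
  · rintro ⟨F, hF, ⟨e⟩⟩
    exact hF.memOP.isOuterplanar.of_injective e.symm.injective fun _ _ h => e.symm.map_rel_iff.2 h
  · obtain ⟨a⟩ := ‹Nonempty V›
    -- With both labels at one vertex, admissibility asks only for outerplanarity of `G`.
    exact ⟨BilabelledGraph.ofLoopGraph G a a,
      BilabelledGraph.Admissible.inL ⟨fun _ => h, fun h => absurd rfl h⟩, ⟨RelIso.refl _⟩⟩
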